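/- Let $\nu\ge1$, write points of $\mathbb R^\nu$ as $k=(k_1,\dots,k_\nu)$, and put $y=k_1$, $z=(k_2,\dots,k_\nu)$. Say that a smooth function $f:\mathbb R^\nu\to\mathbb R$ *reduces to* $g(\tilde k_1)$ at the origin if, in some neighbourhood of $0$, there is a regular (smooth with smooth inverse) change of variables $k\mapsto\tilde k$ fixing the origin such that $f=a+g(\tilde k_1)+Q(\tilde k_2,\dots,\tilde k_\nu)$, with $a$ a constant and $Q$ a nondegenerate quadratic form in $\nu-1$ variables. The germ of $f$ at $0$ has a singularity of type $A_\mu^{\pm}$ if $f$ reduces to $\pm\tilde k_1^{\mu+1}$, and of type $A_\mu$ if it is of type $A_\mu^+$ or $A_\mu^-$. **Statement.** There are polynomials $P_\mu$, $\mu=2,3,\dots$ (depending only on $\nu$ and $\mu$), with integer coefficients and vanishing free term, in variables that stand for the partial derivatives $$\frac{\partial^{i_1+\dots+i_\nu}f(0)}{\partial k_1^{i_1}\cdots\partial k_\nu^{i_\nu}},\qquad 3\le i_1+\dots+i_\nu\le\mu,\quad (i_2,\dots,i_\nu)\ne(0,\dots,0),$$ and for the components of the inverse $f_{z^2}^{-1}$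 of the matrix $f_{z^2}=\bigl\|\frac{\partial^2f(0)}{\partial k_i\partial k_j}\bigr\|_{i,j=2,\dots,\nu}$, such that the following holds for every smooth function $f:\mathbb R^\nu\to\mathbb R$ for which $0$ is a critical point and the kernel of the second differential of $f$ at $0$ is the $k_1$-axis. Put $$a_\mu=\frac{\partial^{\mu+1}f(0)}{\partial k_1^{\mu+1}}+P_\mu,\qquad \mu=2,3,\dots,$$ where $P_\mu$ is evaluated at the derivatives of $f$ and the components of $f_{z^2}^{-1}$. 1. For $\mu=2,3,4,5$ these numbers are as follows. Here $f_{y^m}$ is the $m$-th partial derivative with respect to $y$ at $0$; $f_{y^mz}$ is the vector of the derivatives $\partial^{m+1}f(0)/\partial y^m\partial k_i$ $(i=2,\dots,\nu)$; $f_{y^mz^2}$ is the matrix of the derivatives $\partial^{m+2}f(0)/\partial y^m\partial k_i\partial k_j$ $(i,j=2,\dots,\nu)$; $f_{z^3}[v]^3=\sum_{i,j,l=2}^\nu \frac{\partial^3f(0)}{\partial k_i\partial k_j\partial k_l}v_iv_jv_l$; and $\langle\cdot,\cdot\rangle$ is the standard dot product on $\mathbb R^{\nu-1}$. With $v=f_{z^2}^{-1}f_{y^2z}$: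 $$a_2=f_{y^3},\qquad a_3=f_{y^4}-3\langle f_{y^2z},v\rangle,\qquad a_4=f_{y^5}-\bigl\langle f_{y^2z},\,f_{z^2}^{-1}\bigl(10f_{y^3z}-15f_{yz^2}v\bigr)\bigr\rangle,$$ $$a_5=f_{y^6}-15\bigl\langle f_{y^2z},\,f_{z^2}^{-1}\bigl(f_{y^4z}-4f_{yz^2}f_{z^2}^{-1}f_{y^3z}+6f_{yz^2}f_{z^2}^{-1}f_{yz^2}v\bigr)\bigr\rangle-10\langle f_{y^3z},f_{z^2}^{-1}f_{y^3z}\rangle+45\langle v,f_{y^2z^2}v\rangle-15f_{z^3}[v]^3.$$ 2. For every $\mu\ge2$, the germ of $f$ at the origin has a singularity of type $A_\mu$ if and only if $$a_2=\dots=a_{\mu-1}=0,\qquad a_\mu\ne0.\tag{$*$}$$ 3. For every $\mu\ge2$, if $(*)$ holds, then $f$ reduces to $a_\mu\tilde k_1^{\mu+1}$ at the origin. In particular, $f$ is of type $A_\mu^+$ if $a_\mu>0$ and of type $A_\mu^-$ if $a_\mu<0$. -/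

import Mathlib

open scoped ContDiff Matrix

noncomputable section

namespace SingularityA

/-! Points of `ℝ^ν`, with `ν = n + 1`, are functions `k : Fin (n + 1) → ℝ`. The coordinate `k 0`
is the distinguished variable `k_1` (also denoted `y`); the coordinates `k i.succ`, `i : Fin n`,
are the remaining variables `k_2, …, k_ν` (also denoted `z`). -/

/-- The first-order partial derivative `∂f/∂k_i`, as a function. -/
def partialD {m : ℕ} (i : Fin m) (f : (Fin m → ℝ) → ℝ) : (Fin m → ℝ) → ℝ :=
  fun x => fderiv ℝ f x (Pi.single i 1)

/-- The iterated partial derivative `∂^{α_1 + ⋯ + α_m} f / ∂k_1^{α_1} ⋯ ∂k_m^{α_m}`. -/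
def multiD {m : ℕ} (α : Fin m → ℕ) (f : (Fin m → ℝ) → ℝ) : (Fin m → ℝ) → ℝ :=
  (List.finRange m).foldr (fun i g => (partialD i)^[α i] g) f

/-- The origin is a critical point of `f`, and the kernel of the second differential of `f` at the
origin is the first coordinate axis. -/
def KernelIsFirstAxis {n : ℕ} (f : (Fin (n + 1) → ℝ) → ℝ) : Prop :=
  fderiv ℝ f 0 = 0 ∧
    LinearMap.ker (fderiv ℝ (fderiv ℝ f) 0).toLinearMap =
      Submodule.span ℝ {(Pi.single 0 1 : Fin (n + 1) → ℝ)}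

/-- Near the origin, `f` reduces to the form `a + g(k̃_1) + Q(k̃_2, …, k̃_ν)` by a smooth regular
change of variables `k ↦ k̃ = φ k` leaving the origin fixed, where `a` is a constant and `Q` is a
nondegenerate quadratic form in the remaining `ν - 1` variables. -/
def ReducesTo {n : ℕ} (f : (Fin (n + 1) → ℝ) → ℝ) (g : ℝ → ℝ) : Prop :=
  ∃ (a : ℝ) (Q : QuadraticForm ℝ (Fin n → ℝ))
    (φ : OpenPartialHomeomorph (Fin (n + 1) → ℝ) (Fin (n + 1) → ℝ)),
    Q.Nondegenerate ∧
    0 ∈ φ.source ∧ φ 0 = 0 ∧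
    ContDiffOn ℝ ∞ φ φ.source ∧ ContDiffOn ℝ ∞ φ.symm φ.target ∧
    ∀ k ∈ φ.source, f k = a + g (φ k 0) + Q (fun i : Fin n => φ k i.succ)

/-- The germ of `f` at the origin has a singularity of type `A_μ^+`
(normal form `+x^{μ+1}`). -/
def IsTypeAPlus {n : ℕ} (μ : ℕ) (f : (Fin (n + 1) → ℝ) → ℝ) : Prop :=
  ReducesTo f (fun x => x ^ (μ + 1))

/-- The germ of `f` at the origin has a singularity of type `A_μ^-`
(normal form `-x^{μ+1}`). -/
def IsTypeAMinus {n : ℕ} (μ : ℕ) (f : (Fin (n + 1) → ℝ) → ℝ) : Prop :=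
  ReducesTo f (fun x => -x ^ (μ + 1))

/-- The germ of `f` at the origin has a singularity of type `A_μ`, i.e. `A_μ^+` or `A_μ^-`. -/
def IsTypeA {n : ℕ} (μ : ℕ) (f : (Fin (n + 1) → ℝ) → ℝ) : Prop :=
  IsTypeAPlus μ f ∨ IsTypeAMinus μ f

/-- Multi-indices `(i_1, …, i_ν)` with `3 ≤ i_1 + ⋯ + i_ν ≤ μ`, except those that stand for a
derivative with respect to `k_1` only. -/
def MixedIndex (n μ : ℕ) : Type :=
  {α : Fin (n + 1) → ℕ // 3 ≤ ∑ i, α i ∧ ∑ i, α i ≤ μ ∧ ∃ i : Fin n, α i.succ ≠ 0}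

/-- The inverse of the matrix `‖∂²f(0)/∂k_i∂k_j‖`, `i, j = 2, …, ν`. -/
def invHess {n : ℕ} (f : (Fin (n + 1) → ℝ) → ℝ) : Matrix (Fin n) (Fin n) ℝ :=
  (Matrix.of fun i j => multiD (Pi.single i.succ 1 + Pi.single j.succ 1) f 0)⁻¹

/-- `∂^{μ+1}f(0)/∂k_1^{μ+1}` plus the value of the polynomial `p` at the partial derivatives of `f`
at the origin and the components of the inverse matrix `invHess f`. -/
def coeffA {n μ : ℕ} (p : MvPolynomial (MixedIndex n μ ⊕ Fin n × Fin n) ℤ)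
    (f : (Fin (n + 1) → ℝ) → ℝ) : ℝ :=
  multiD (Pi.single 0 (μ + 1)) f 0 +
    MvPolynomial.aeval
      (Sum.elim (fun α : MixedIndex n μ => multiD α.1 f 0) (fun q => invHess f q.1 q.2)) p

/-- `f_{y^m}`. -/
def fY {n : ℕ} (f : (Fin (n + 1) → ℝ) → ℝ) (m : ℕ) : ℝ :=
  multiD (Pi.single 0 m) f 0

/-- The vector `f_{y^m z}`. -/
def fYZ {n : ℕ} (f : (Fin (n + 1) → ℝ) → ℝ) (m : ℕ) : Fin n → ℝ :=
  fun i => multiD (Pi.single 0 m + Pi.single i.succ 1) f 0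

/-- The symmetric matrix `f_{y^m z^2}`. -/
def fYZZ {n : ℕ} (f : (Fin (n + 1) → ℝ) → ℝ) (m : ℕ) : Matrix (Fin n) (Fin n) ℝ :=
  Matrix.of fun i j =>
    multiD (Pi.single 0 m + Pi.single i.succ 1 + Pi.single j.succ 1) f 0

/-- The cubic form of the symmetric tensor `f_{z^3}`, evaluated at the vector `v`. -/
def fZZZ {n : ℕ} (f : (Fin (n + 1) → ℝ) → ℝ) (v : Fin n → ℝ) : ℝ :=
  ∑ i, ∑ j, ∑ l,
    multiD (Pi.single i.succ 1 + Pi.single j.succ 1 + Pi.single l.succ 1) f 0 * v i * v j * v l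

/-- The tabulated value of `a_2`. -/
def tableA2 {n : ℕ} (f : (Fin (n + 1) → ℝ) → ℝ) : ℝ := fY f 3

/-- The tabulated value of `a_3`. -/
def tableA3 {n : ℕ} (f : (Fin (n + 1) → ℝ) → ℝ) : ℝ :=
  fY f 4 - 3 * (fYZ f 2 ⬝ᵥ (invHess f *ᵥ fYZ f 2))

/-- The tabulated value of `a_4`. -/
def tableA4 {n : ℕ} (f : (Fin (n + 1) → ℝ) → ℝ) : ℝ :=
  fY f 5 - fYZ f 2 ⬝ᵥ
    (invHess f *ᵥ ((10 : ℝ) • fYZ f 3 - (15 : ℝ) • (fYZZ f 1 *ᵥ (invHess f *ᵥ fYZ f 2))))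

/-- The tabulated value of `a_5`. -/
def tableA5 {n : ℕ} (f : (Fin (n + 1) → ℝ) → ℝ) : ℝ :=
  fY f 6
    - 15 * (fYZ f 2 ⬝ᵥ (invHess f *ᵥ
        (fYZ f 4 - (4 : ℝ) • (fYZZ f 1 *ᵥ (invHess f *ᵥ fYZ f 3))
          + (6 : ℝ) • (fYZZ f 1 *ᵥ (invHess f *ᵥ (fYZZ f 1 *ᵥ (invHess f *ᵥ fYZ f 2)))))))
    - 10 * (fYZ f 3 ⬝ᵥ (invHess f *ᵥ fYZ f 3))
    + 45 * ((invHess f *ᵥ fYZ f 2) ⬝ᵥ (fYZZ f 2 *ᵥ (invHess f *ᵥ fYZ f 2)))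
    - 15 * fZZZ f (invHess f *ᵥ fYZ f 2)

end SingularityA

end

/-!
Write `y` for the first coordinate and `z` for the others. The second differential of `f` is
nondegenerate in the direction of `z`, so the equation `f_z(y, z) = 0` has near the origin a unique
smooth solution `z = ζ(y)` (`exists_isCriticalSection`). The number `a_μ` is the derivative of order
`μ + 1` at `0` of the function `h(y) = f(y, ζ(y))` of one variable.

*Polynomials.* Because `f_z` vanishes along the curve `γ(y) = (y, ζ(y))`, the derivative `h'` is
`f_y ∘ γ`. The chain rule and the Leibniz rule give a recursion for the derivatives at `0` of
`∂^α f ∘ γ` (`curveD_succ`), and the identity `f_z ∘ γ = 0` determines the derivatives of `ζ` one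
after the other, with `f_{z²}⁻¹` as the only denominator (`sectionD_eq`). All coefficients are
integers, and counting orders, with `ζ'(0) = 0` and `f_{yz}(0) = 0`, shows that `a_μ` involves mixed
derivatives of orders between `3` and `μ` only (`exists_polynomial_coeffA`). Unrolling the same
recursion gives the values of `a_2, …, a_5`.

*Reduction.* Taylor's formula with integral remainder about the point `(y, ζ(y))` gives
`f(y, z) = h(y) + ⟨w, M(y, z) w⟩` with `w = z - ζ(y)` and `M` smooth and symmetric, `M(0)`
nonsingular. With `B` the square root of `M(0)⁻¹ M` near the identity, `⟨w, M w⟩ = ⟨Bw, M(0) Bw⟩`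
(`exists_smooth_congruence`), so `Bw` serves as the transversal part of the new coordinates. If
`a_μ` is the first nonzero coefficient, then `h(y) - h(0)` is `y^{μ+1}` times a smooth function
without zeros, hence equal to `c θ(y)^{μ+1}` for a new coordinate `θ` and any `c` of the sign of
`a_μ` (`exists_coordinate_pow`, `IsCriticalSection.reducesTo`).

*Uniqueness.* That `f` reduces to `c x^{μ+1}` for at most one `μ` follows from an invariant: the
largest order to which `df` vanishes along a curve through the origin with nonzero velocity
(`GradientVanishes`). It equals `μ` for the normal form. If `a_2, …, a_μ` all vanish, it is greater
than `μ`, as `γ` shows.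
-/

open Filter Topology

namespace SingularityA

/-! ### Smooth functions: integrals, extensions, division, inverses -/

section Analysis

universe u

variable {E F : Type u} [NormedAddCommGroup E] [NormedSpace ℝ E] [NormedAddCommGroup F]
  [NormedSpace ℝ F]

lemma hasFDerivAt_parametric_integral [ProperSpace E] {G : E × ℝ → F}
    (hG : ContDiff ℝ 1 G) (x : E) :
    HasFDerivAt (fun x => ∫ t in (0 : ℝ)..1, G (x, t))
      (∫ t in (0 : ℝ)..1, (fderiv ℝ G (x, t)).comp (ContinuousLinearMap.inl ℝ E ℝ)) x := by
  have hd : Differentiable ℝ G := hG.differentiable (by simp)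
  have hc : Continuous G := hG.continuous
  have hc' : Continuous fun p : E × ℝ =>
      (fderiv ℝ G p).comp (ContinuousLinearMap.inl ℝ E ℝ) :=
    (hG.continuous_fderiv (by simp)).clm_comp continuous_const
  obtain ⟨C, hC⟩ := ((isCompact_closedBall x 1).prod (isCompact_Icc (a := (0 : ℝ)) (b := 1))
    ).exists_bound_of_continuousOn hc'.continuousOn
  refine intervalIntegral.hasFDerivAt_integral_of_dominated_of_fderiv_le
    (s := Metric.closedBall x 1) (bound := fun _ => C)
    (F' := fun x t => (fderiv ℝ G (x, t)).comp (ContinuousLinearMap.inl ℝ E ℝ))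
    (Metric.closedBall_mem_nhds x one_pos) ?_ ?_ ?_ ?_ ?_ ?_
  · exact Eventually.of_forall fun y =>
      (hc.comp (Continuous.prodMk_right y)).aestronglyMeasurable
  · exact (hc.comp (Continuous.prodMk_right x)).intervalIntegrable _ _
  · exact (hc'.comp (Continuous.prodMk_right x)).aestronglyMeasurable
  · refine Eventually.of_forall fun t ht y hy => hC (y, t) ⟨hy, ?_⟩
    rw [Set.uIoc_of_le zero_le_one] at ht
    exact ⟨ht.1.le, ht.2⟩
  · simp
  · refine Eventually.of_forall fun t _ y _ => ?_
    exact (hd (y, t)).hasFDerivAt.comp y (hasFDerivAt_prodMk_left y t)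

/-- Differentiation under the integral sign, iterated. -/
lemma contDiff_parametric_integral [ProperSpace E] {G : E × ℝ → F} (hG : ContDiff ℝ ∞ G) :
    ContDiff ℝ ∞ fun x => ∫ t in (0 : ℝ)..1, G (x, t) := by
  refine contDiff_infty.2 fun n => ?_
  induction n generalizing F with
  | zero =>
    exact contDiff_zero.2 (intervalIntegral.continuous_parametric_intervalIntegral_of_continuous'
      (f := fun x t => G (x, t)) hG.continuous 0 1)
  | succ n ih =>
    refine contDiff_succ_iff_hasFDerivAt.2 ⟨_, ih (G := fun p =>
      (fderiv ℝ G p).comp (ContinuousLinearMap.inl ℝ E ℝ)) ?_,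
      hasFDerivAt_parametric_integral (hG.of_le (by exact_mod_cast le_top))⟩
    exact (hG.fderiv_right (m := ∞) (by simp)).clm_comp contDiff_const

/-- Taylor's formula of order two with integral remainder. -/
lemma taylor_two_integral {f : E → ℝ} (hf : ContDiff ℝ ∞ f) (p w : E) :
    f (p + w) = f p + fderiv ℝ f p w +
      ∫ t in (0 : ℝ)..1, (1 - t) * fderiv ℝ (fderiv ℝ f) (p + t • w) w w := by
  have hline : ∀ t : ℝ, HasDerivAt (fun t : ℝ => p + t • w) w t := fun t => by
    simpa using ((hasDerivAt_id t).smul_const w).const_add p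
  have h0 : ∀ t : ℝ, HasDerivAt (fun t : ℝ => f (p + t • w)) (fderiv ℝ f (p + t • w) w) t :=
    fun t => ((hf.differentiable (by simp)) _).hasFDerivAt.comp_hasDerivAt t (hline t)
  have hf1 : ContDiff ℝ ∞ (fderiv ℝ f) := hf.fderiv_right (m := ∞) (by simp)
  have hf2 : ContDiff ℝ ∞ (fderiv ℝ (fderiv ℝ f)) := hf1.fderiv_right (m := ∞) (by simp)
  have h1 : ∀ t : ℝ, HasDerivAt (fun t : ℝ => fderiv ℝ f (p + t • w) w)
      (fderiv ℝ (fderiv ℝ f) (p + t • w) w w) t := fun t => by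
    have := ((hf1.differentiable (by simp)) _).hasFDerivAt.comp_hasDerivAt t (hline t)
    simpa using this.clm_apply (hasDerivAt_const t w)
  have h2 : ∀ t : ℝ, HasDerivAt (fun t : ℝ => f (p + t • w) + (1 - t) * fderiv ℝ f (p + t • w) w)
      ((1 - t) * fderiv ℝ (fderiv ℝ f) (p + t • w) w w) t := fun t => by
    have := (h0 t).add (((hasDerivAt_id t).const_sub 1).mul (h1 t))
    refine this.congr_deriv ?_
    simp
  have hcont : Continuous fun t : ℝ => (1 - t) * fderiv ℝ (fderiv ℝ f) (p + t • w) w w := by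
    have := hf2.continuous
    fun_prop
  rw [intervalIntegral.integral_eq_sub_of_hasDerivAt (fun t _ => h2 t)
    (hcont.intervalIntegrable _ _)]
  simp

/-- A germ of a smooth map extends to a globally smooth map. -/
lemma exists_contDiff_eventuallyEq [HasContDiffBump E] {g : E → F} {x₀ : E}
    (hg : ∀ᶠ x in 𝓝 x₀, ContDiffAt ℝ ∞ g x) :
    ∃ G : E → F, ContDiff ℝ ∞ G ∧ G =ᶠ[𝓝 x₀] g := by
  obtain ⟨r, hr, hball⟩ := Metric.eventually_nhds_iff.1 hg
  let χ : ContDiffBump x₀ := ⟨r / 4, r / 2, by linarith, by linarith⟩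
  refine ⟨fun x => χ x • g x, contDiff_iff_contDiffAt.2 fun x => ?_, ?_⟩
  · by_cases hx : dist x x₀ < r
    · exact χ.contDiffAt.smul (hball hx)
    · have : (fun x => χ x • g x) =ᶠ[𝓝 x] fun _ => 0 := by
        have hopen : {y : E | r / 2 < dist y x₀} ∈ 𝓝 x :=
          (isOpen_lt continuous_const (by fun_prop)).mem_nhds (by simp; linarith)
        filter_upwards [hopen] with y hy
        rw [χ.zero_of_le_dist (le_of_lt hy), zero_smul]
      exact contDiffAt_const.congr_of_eventuallyEq this
  · filter_upwards [χ.eventuallyEq_one] with x hx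
    simp [hx]

/-- The smooth inverse function theorem, with smoothness of both directions on the whole domain of
the local inverse. Smoothness of `g` is needed at all points near `x₀`: `ContDiffAt ℝ ∞ g x₀` only
gives, for each finite order, a neighborhood on which `g` is differentiable to that order. -/
lemma exists_smooth_openPartialHomeomorph [CompleteSpace E] {g : E → F} {x₀ : E}
    (hg : ∀ᶠ x in 𝓝 x₀, ContDiffAt ℝ ∞ g x) (e : E ≃L[ℝ] F)
    (he : HasFDerivAt g (e : E →L[ℝ] F) x₀) {U : Set E} (hU : U ∈ 𝓝 x₀) :
    ∃ φ : OpenPartialHomeomorph E F, x₀ ∈ φ.source ∧ φ.source ⊆ U ∧ (φ : E → F) = g ∧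
      ContDiffOn ℝ ∞ φ φ.source ∧ ContDiffOn ℝ ∞ φ.symm φ.target := by
  have hg0 : ContDiffAt ℝ ∞ g x₀ := hg.self_of_nhds
  have hstrict : HasStrictFDerivAt g (e : E →L[ℝ] F) x₀ := hg0.hasStrictFDerivAt' he (by simp)
  have hinv : ∀ᶠ x in 𝓝 x₀, fderiv ℝ g x ∈ Set.range
      (ContinuousLinearEquiv.toContinuousLinearMap : (E ≃L[ℝ] F) → E →L[ℝ] F) := by
    have hcont : ContinuousAt (fderiv ℝ g) x₀ :=
      (hg0.fderiv_right (m := 0) (by simp)).continuousAt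
    refine hcont.eventually_mem ?_
    rw [he.fderiv]
    exact e.nhds
  obtain ⟨V, hVsub, hVo, hxV⟩ := mem_nhds_iff.1 ((hg.and hinv).and hU)
  let ψ := hstrict.toOpenPartialHomeomorph g
  let φ := ψ.restrOpen V hVo
  have hφ : (φ : E → F) = g := rfl
  have hsrc : φ.source ⊆ V := fun x hx => by
    rw [OpenPartialHomeomorph.restrOpen_source] at hx
    exact hx.2
  refine ⟨φ, ?_, fun x hx => (hVsub (hsrc hx)).2, hφ, ?_, ?_⟩
  · rw [OpenPartialHomeomorph.restrOpen_source]
    exact ⟨hstrict.mem_toOpenPartialHomeomorph_source, hxV⟩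
  · rw [hφ]
    exact fun x hx => (hVsub (hsrc hx)).1.1.contDiffWithinAt
  · intro y hy
    have hmem := hVsub (hsrc (φ.map_target hy))
    obtain ⟨e', he'⟩ := hmem.1.2
    refine (φ.contDiffAt_symm (f₀' := e') hy ?_ ?_).contDiffWithinAt
    · rw [hφ, he']
      exact (hmem.1.1.differentiableAt (by simp)).hasFDerivAt
    · exact hmem.1.1

end Analysis

/-- Hadamard's lemma in one variable: a smooth function that vanishes at `0` is divisible by the
variable. -/
lemma exists_eq_mul_of_zero {g : ℝ → ℝ} (hg : ContDiff ℝ ∞ g) (h0 : g 0 = 0) :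
    ∃ u : ℝ → ℝ, ContDiff ℝ ∞ u ∧ ∀ y, g y = y * u y := by
  have hg' : ContDiff ℝ ∞ (deriv g) := ((contDiff_succ_iff_deriv (n := ∞)).1 (by simpa using hg)).2.2
  refine ⟨fun y => ∫ t in (0 : ℝ)..1, deriv g (t * y),
    contDiff_parametric_integral (G := fun p : ℝ × ℝ => deriv g (p.2 * p.1)) (by fun_prop), ?_⟩
  intro y
  have h1 : ∀ t : ℝ, HasDerivAt (fun t : ℝ => g (t * y)) (y * deriv g (t * y)) t := fun t => by
    have := ((hg.differentiable (by simp)) (t * y)).hasDerivAt.comp t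
      ((hasDerivAt_id t).mul_const y)
    refine this.congr_deriv ?_
    simp [mul_comm]
  have hcont : Continuous fun t : ℝ => y * deriv g (t * y) := by
    have := hg'.continuous
    fun_prop
  have := intervalIntegral.integral_eq_sub_of_hasDerivAt (fun t _ => h1 t)
    (hcont.intervalIntegrable 0 1)
  rw [intervalIntegral.integral_const_mul] at this
  simpa [h0] using this.symm

lemma deriv_id_mul {u : ℝ → ℝ} (hu : ContDiff ℝ ∞ u) :
    deriv (fun y => y * u y) = fun y => u y + y * deriv u y := by
  funext y
  have := (hasDerivAt_id' y).fun_mul ((hu.differentiable (by simp)) y).hasDerivAt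
  simpa using this.deriv

lemma iteratedDeriv_id_mul {u : ℝ → ℝ} (hu : ContDiff ℝ ∞ u) (k : ℕ) :
    iteratedDeriv (k + 1) (fun y => y * u y) 0 = (k + 1) * iteratedDeriv k u 0 := by
  induction k generalizing u with
  | zero => simp [iteratedDeriv_one, deriv_id_mul hu]
  | succ k ih =>
    have hu' : ContDiff ℝ ∞ (deriv u) :=
      ((contDiff_succ_iff_deriv (n := ∞)).1 (by simpa using hu)).2.2
    rw [iteratedDeriv_succ', deriv_id_mul hu, iteratedDeriv_fun_add
      (contDiff_infty.1 hu _).contDiffAt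
      (contDiff_fun_id.mul (contDiff_infty.1 hu' _)).contDiffAt, ih hu', ← iteratedDeriv_succ']
    push_cast
    ring

/-- A smooth function whose derivatives of order less than `m` vanish at `0` is divisible by the
`m`-th power of the variable, and the quotient has at `0` the `m`-th Taylor coefficient. -/
lemma exists_eq_pow_mul {g : ℝ → ℝ} (hg : ContDiff ℝ ∞ g) (m : ℕ)
    (h0 : ∀ j < m, iteratedDeriv j g 0 = 0) :
    ∃ u : ℝ → ℝ, ContDiff ℝ ∞ u ∧ (∀ y, g y = y ^ m * u y) ∧
      iteratedDeriv m g 0 = m.factorial * u 0 := by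
  induction m generalizing g with
  | zero => exact ⟨g, hg, by simp, by simp⟩
  | succ m ih =>
    obtain ⟨u, hu, hgu⟩ := exists_eq_mul_of_zero hg (by simpa using h0 0 (by simp))
    have hk : ∀ k, iteratedDeriv (k + 1) g 0 = (k + 1) * iteratedDeriv k u 0 := fun k => by
      rw [← iteratedDeriv_id_mul hu k, ← funext hgu]
    obtain ⟨v, hv, huv, hv0⟩ := ih hu fun j hj => by
      have := h0 (j + 1) (by omega)
      rw [hk] at this
      exact (mul_eq_zero.1 this).resolve_left (by positivity)
    refine ⟨v, hv, fun y => by rw [hgu, huv]; ring, ?_⟩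
    rw [hk, hv0, Nat.factorial_succ]
    push_cast
    ring

/-- In a complete normed algebra there is near `1` a smooth square root. For every continuous unital
anti-endomorphism `τ`, the square roots of `τ`-symmetric elements near `1` are `τ`-symmetric. -/
lemma exists_smooth_sqrt (𝔸 : Type) [NormedRing 𝔸] [NormedAlgebra ℝ 𝔸] [CompleteSpace 𝔸]
    [HasContDiffBump 𝔸] :
    ∃ S : 𝔸 → 𝔸, ContDiff ℝ ∞ S ∧ S 1 = 1 ∧ (∀ᶠ x in 𝓝 (1 : 𝔸), S x * S x = x) ∧
      ∀ τ : 𝔸 → 𝔸, Continuous τ → τ 1 = 1 → (∀ a b, τ (a * b) = τ b * τ a) →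
        ∀ᶠ x in 𝓝 (1 : 𝔸), τ x = x → τ (S x) = S x := by
  -- the derivative of `x ↦ x * x` at `1` is multiplication by `2`
  let e : 𝔸 ≃L[ℝ] 𝔸 := ContinuousLinearEquiv.smulLeft (Units.mk0 (2 : ℝ) two_ne_zero)
  have he : HasFDerivAt (fun x : 𝔸 => x * x) (e : 𝔸 →L[ℝ] 𝔸) 1 := by
    have := (hasFDerivAt_id (𝕜 := ℝ) (1 : 𝔸)).mul' (hasFDerivAt_id (1 : 𝔸))
    refine this.congr_fderiv ?_
    ext x
    simp [e, Units.smul_def, two_smul]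
  obtain ⟨φ, h1, -, hφ, -, hsymm⟩ := exists_smooth_openPartialHomeomorph
    (g := fun x : 𝔸 => x * x) (x₀ := 1)
    (Eventually.of_forall fun x => (contDiff_id.mul contDiff_id).contDiffAt) e he univ_mem
  have hφ1 : φ 1 = 1 := by rw [hφ]; simp
  have h1t : (1 : 𝔸) ∈ φ.target := hφ1 ▸ φ.map_source h1
  have htn : φ.target ∈ 𝓝 (1 : 𝔸) := φ.open_target.mem_nhds h1t
  obtain ⟨S, hS, hSφ⟩ := exists_contDiff_eventuallyEq (g := φ.symm) (x₀ := (1 : 𝔸)) (by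
    filter_upwards [φ.open_target.mem_nhds h1t] with x hx
    exact hsymm.contDiffAt (φ.open_target.mem_nhds hx))
  have hsq : ∀ᶠ x in 𝓝 (1 : 𝔸), S x * S x = x := by
    filter_upwards [hSφ, htn] with x hx hxt
    have := φ.right_inv hxt
    rwa [← hx, hφ] at this
  have hS1 : S 1 = 1 := by
    rw [hSφ.self_of_nhds]
    nth_rewrite 1 [← hφ1]
    exact φ.left_inv h1
  refine ⟨S, hS, hS1, hsq, fun τ hτ hτ1 hmul => ?_⟩
  have hSsrc : ∀ᶠ x in 𝓝 (1 : 𝔸), S x ∈ φ.source :=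
    hS.continuous.continuousAt.eventually_mem (by rw [hS1]; exact φ.open_source.mem_nhds h1)
  have hτsrc : ∀ᶠ x in 𝓝 (1 : 𝔸), τ (S x) ∈ φ.source :=
    (hτ.comp hS.continuous).continuousAt.eventually_mem
      (by simp only [Function.comp, hS1, hτ1]; exact φ.open_source.mem_nhds h1)
  filter_upwards [hSsrc, hτsrc, hsq] with x h1 h2 h3 hx
  -- `S x` and `τ (S x)` have the same square, and squaring is injective near `1`
  refine φ.injOn h2 h1 ?_
  rw [hφ]
  simp only
  rw [← hmul, h3, hx]

/-! ### Partial derivatives -/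

section Partial

variable {m : ℕ} {f : (Fin m → ℝ) → ℝ}

lemma contDiff_partialD (hf : ContDiff ℝ ∞ f) (i : Fin m) : ContDiff ℝ ∞ (partialD i f) :=
  (hf.fderiv_right (m := ∞) (by simp)).clm_apply contDiff_const

lemma fderiv_partialD (hf : ContDiff ℝ ∞ f) (j : Fin m) (x v : Fin m → ℝ) :
    fderiv ℝ (partialD j f) x v = fderiv ℝ (fderiv ℝ f) x v (Pi.single j 1) := by
  have h : DifferentiableAt ℝ (fderiv ℝ f) x :=
    (hf.fderiv_right (m := ∞) (by simp)).differentiable (by simp) x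
  have := (h.hasFDerivAt.clm_apply (hasFDerivAt_const (Pi.single j (1 : ℝ)) x)).fderiv
  change fderiv ℝ (fun y => fderiv ℝ f y (Pi.single j 1)) x v = _
  rw [this]
  simp

lemma partialD_partialD (hf : ContDiff ℝ ∞ f) (i j : Fin m) (x : Fin m → ℝ) :
    partialD i (partialD j f) x =
      fderiv ℝ (fderiv ℝ f) x (Pi.single i 1) (Pi.single j 1) :=
  fderiv_partialD hf j x _

lemma fderiv_fderiv_symm (hf : ContDiff ℝ ∞ f) (x v w : Fin m → ℝ) :
    fderiv ℝ (fderiv ℝ f) x v w = fderiv ℝ (fderiv ℝ f) x w v :=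
  hf.contDiffAt.isSymmSndFDerivAt
    (by simpa using (WithTop.coe_le_coe.2 le_top : ((2 : ℕ∞) : WithTop ℕ∞) ≤ ∞)) v w

lemma partialD_comm (hf : ContDiff ℝ ∞ f) (i j : Fin m) :
    partialD i (partialD j f) = partialD j (partialD i f) := by
  funext x
  rw [partialD_partialD hf, partialD_partialD hf, fderiv_fderiv_symm hf]

lemma contDiff_iterate_partialD (hf : ContDiff ℝ ∞ f) (i : Fin m) (k : ℕ) :
    ContDiff ℝ ∞ ((partialD i)^[k] f) := by
  induction k with
  | zero => exact hf
  | succ k ih =>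
    rw [Function.iterate_succ_apply']
    exact contDiff_partialD ih i

lemma partialD_iterate_comm (hf : ContDiff ℝ ∞ f) (i j : Fin m) (k : ℕ) :
    partialD i ((partialD j)^[k] f) = (partialD j)^[k] (partialD i f) := by
  induction k with
  | zero => rfl
  | succ k ih =>
    rw [Function.iterate_succ_apply', Function.iterate_succ_apply',
      partialD_comm (contDiff_iterate_partialD hf j k), ih]

lemma contDiff_foldr_partialD (hf : ContDiff ℝ ∞ f) (α : Fin m → ℕ) (l : List (Fin m)) :
    ContDiff ℝ ∞ (l.foldr (fun i g => (partialD i)^[α i] g) f) := by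
  induction l with
  | nil => exact hf
  | cons j l ih => exact contDiff_iterate_partialD ih j _

lemma contDiff_multiD (hf : ContDiff ℝ ∞ f) (α : Fin m → ℕ) : ContDiff ℝ ∞ (multiD α f) :=
  contDiff_foldr_partialD hf α _

lemma partialD_foldr (hf : ContDiff ℝ ∞ f) (α : Fin m → ℕ) (i : Fin m) (l : List (Fin m))
    (hl : l.Nodup) (hi : i ∈ l) :
    partialD i (l.foldr (fun i g => (partialD i)^[α i] g) f) =
      l.foldr (fun j g => (partialD j)^[(α + Pi.single i 1 : Fin m → ℕ) j] g) f := by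
  induction l with
  | nil => simp at hi
  | cons j l ih =>
    simp only [List.foldr_cons]
    rw [List.nodup_cons] at hl
    by_cases hij : i = j
    · subst hij
      have hcongr : l.foldr (fun j g => (partialD j)^[(α + Pi.single i 1 : Fin m → ℕ) j] g) f =
          l.foldr (fun i g => (partialD i)^[α i] g) f := by
        refine List.foldr_ext _ _ _ fun k hk g => ?_
        have : k ≠ i := fun h => hl.1 (h ▸ hk)
        simp [this]
      rw [hcongr]
      simp [Function.iterate_succ_apply']
    · have hil : i ∈ l := by simpa [hij] using hi
      rw [partialD_iterate_comm (contDiff_foldr_partialD hf α l), ih hl.2 hil]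
      simp [Ne.symm hij]

lemma partialD_multiD (hf : ContDiff ℝ ∞ f) (α : Fin m → ℕ) (i : Fin m) :
    partialD i (multiD α f) = multiD (α + Pi.single i 1) f :=
  partialD_foldr hf α i _ (List.nodup_finRange m) (List.mem_finRange i)

lemma multiD_zero : multiD (0 : Fin m → ℕ) f = f := by
  simp [multiD]

lemma multiD_single (hf : ContDiff ℝ ∞ f) (i : Fin m) :
    multiD (Pi.single i 1) f = partialD i f := by
  have := partialD_multiD hf 0 i
  rwa [multiD_zero, zero_add, eq_comm] at this

lemma multiD_single_add_single (hf : ContDiff ℝ ∞ f) (i j : Fin m) (x : Fin m → ℝ) :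
    multiD (Pi.single i 1 + Pi.single j 1) f x =
      fderiv ℝ (fderiv ℝ f) x (Pi.single i 1) (Pi.single j 1) := by
  rw [← partialD_multiD hf, multiD_single hf, partialD_comm hf, partialD_partialD hf]

lemma clm_apply_eq_sum {F : Type*} [NormedAddCommGroup F] [NormedSpace ℝ F]
    (L : (Fin m → ℝ) →L[ℝ] F) (v : Fin m → ℝ) :
    L v = ∑ i, v i • L (Pi.single i 1) := by
  conv_lhs => rw [pi_eq_sum_univ' v]
  rw [map_sum]
  simp_rw [map_smul]

end Partial

section Kernel

variable {n : ℕ} {f : (Fin (n + 1) → ℝ) → ℝ}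

/-- The matrix `‖∂²f/∂k_i∂k_j‖`, `i, j = 2, …, ν`, at the origin. -/
noncomputable def hess (f : (Fin (n + 1) → ℝ) → ℝ) : Matrix (Fin n) (Fin n) ℝ :=
  Matrix.of fun i j => multiD (Pi.single i.succ 1 + Pi.single j.succ 1) f 0

lemma hess_apply (hf : ContDiff ℝ ∞ f) (i j : Fin n) : hess f i j =
    fderiv ℝ (fderiv ℝ f) 0 (Pi.single i.succ 1) (Pi.single j.succ 1) :=
  multiD_single_add_single hf _ _ _

lemma hess_transpose (hf : ContDiff ℝ ∞ f) : (hess f)ᵀ = hess f := by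
  ext i j
  rw [Matrix.transpose_apply, hess_apply hf, hess_apply hf, fderiv_fderiv_symm hf]

lemma KernelIsFirstAxis.fderiv_single (hk : KernelIsFirstAxis f) :
    fderiv ℝ (fderiv ℝ f) 0 (Pi.single 0 1) = 0 := by
  have : (Pi.single 0 1 : Fin (n + 1) → ℝ) ∈
      LinearMap.ker (fderiv ℝ (fderiv ℝ f) 0).toLinearMap := by
    rw [hk.2]
    exact Submodule.mem_span_singleton_self _
  simpa using this

lemma KernelIsFirstAxis.multiD_single (hf : ContDiff ℝ ∞ f) (hk : KernelIsFirstAxis f)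
    (i : Fin (n + 1)) : multiD (Pi.single i 1) f 0 = 0 := by
  rw [SingularityA.multiD_single hf, partialD, hk.1]
  rfl

lemma KernelIsFirstAxis.multiD_zero_add_single (hf : ContDiff ℝ ∞ f) (hk : KernelIsFirstAxis f)
    (i : Fin (n + 1)) : multiD (Pi.single 0 1 + Pi.single i 1) f 0 = 0 := by
  rw [multiD_single_add_single hf, hk.fderiv_single]
  rfl

/-- A vector with these properties lies in the kernel of the second differential, since the pairing
with the first basis vector vanishes by symmetry; and it has no component along the kernel. -/
lemma KernelIsFirstAxis.eq_zero (hf : ContDiff ℝ ∞ f) (hk : KernelIsFirstAxis f)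
    {v : Fin (n + 1) → ℝ} (h0 : v 0 = 0)
    (h : ∀ i : Fin n, fderiv ℝ (fderiv ℝ f) 0 v (Pi.single i.succ 1) = 0) : v = 0 := by
  have hker : fderiv ℝ (fderiv ℝ f) 0 v = 0 := by
    ext w
    rw [clm_apply_eq_sum, Fin.sum_univ_succ, fderiv_fderiv_symm hf, hk.fderiv_single]
    simp [h]
  have hmem : v ∈ LinearMap.ker (fderiv ℝ (fderiv ℝ f) 0).toLinearMap := by simpa using hker
  rw [hk.2, Submodule.mem_span_singleton] at hmem
  obtain ⟨c, rfl⟩ := hmem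
  have : c = 0 := by simpa using h0
  simp [this]

lemma KernelIsFirstAxis.isUnit_det_hess (hf : ContDiff ℝ ∞ f) (hk : KernelIsFirstAxis f) :
    IsUnit (hess f).det := by
  rw [← Matrix.isUnit_iff_isUnit_det, ← Matrix.mulVec_injective_iff_isUnit]
  refine (injective_iff_map_eq_zero (Matrix.mulVecLin (hess f))).2 fun w hw => ?_
  have hv : (Fin.cons 0 w : Fin (n + 1) → ℝ) = 0 := by
    refine hk.eq_zero hf (by simp) fun i => ?_
    rw [fderiv_fderiv_symm hf, clm_apply_eq_sum, Fin.sum_univ_succ]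
    have := congrFun hw i
    simp only [Matrix.mulVecLin_apply, Matrix.mulVec, dotProduct, hess_apply hf] at this
    simpa [mul_comm] using this
  funext i
  simpa using congrFun hv i.succ

lemma KernelIsFirstAxis.invHess_mul_hess (hf : ContDiff ℝ ∞ f) (hk : KernelIsFirstAxis f) :
    invHess f * hess f = 1 :=
  Matrix.nonsing_inv_mul _ (hk.isUnit_det_hess hf)

end Kernel

/-! ### The curve of critical points in the transversal variables -/

section CriticalSection

variable {n : ℕ}

/-- The curve `y ↦ (y, ζ(y))`. -/
def graphCurve (ζ : ℝ → Fin n → ℝ) (y : ℝ) : Fin (n + 1) → ℝ := Fin.cons y (ζ y)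

/-- The function `f` satisfies the standing assumptions, and `ζ` is a smooth function with
`ζ(0) = 0` that solves `f_z(y, ζ(y)) = 0` near `y = 0`. The function `ζ` is smooth on the whole
line, but only its germ at `0` matters. -/
structure IsCriticalSection (f : (Fin (n + 1) → ℝ) → ℝ) (ζ : ℝ → Fin n → ℝ) : Prop where
  contDiff : ContDiff ℝ ∞ f
  kernel : KernelIsFirstAxis f
  contDiff_section : ContDiff ℝ ∞ ζ
  section_zero : ζ 0 = 0
  critical : ∀ᶠ y in 𝓝 (0 : ℝ), ∀ i : Fin n, partialD i.succ f (graphCurve ζ y) = 0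

/-- The implicit function theorem, applied to the equation `f_z(y, z) = 0`. -/
lemma exists_isCriticalSection {f : (Fin (n + 1) → ℝ) → ℝ} (hf : ContDiff ℝ ∞ f)
    (hk : KernelIsFirstAxis f) : ∃ ζ, IsCriticalSection f ζ := by
  -- the local inverse of `(y, z) ↦ (y, f_z(y, z))` maps `(y, 0)` to `(y, ζ(y))`
  let g : (Fin (n + 1) → ℝ) → Fin (n + 1) → ℝ :=
    fun k => Fin.cons (k 0) fun i : Fin n => partialD i.succ f k
  have hg : ContDiff ℝ ∞ g := by
    refine contDiff_pi.2 fun i => ?_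
    refine Fin.cases ?_ (fun i => ?_) i
    · exact contDiff_apply ℝ ℝ 0
    · exact contDiff_partialD hf i.succ
  have hL : HasFDerivAt g (fderiv ℝ g 0) 0 := (hg.differentiable (by simp) 0).hasFDerivAt
  have hcomp := hasFDerivAt_pi'.1 hL
  have hL0 : ∀ v, fderiv ℝ g 0 v 0 = v 0 := fun v => by
    have h1 : HasFDerivAt (fun k : Fin (n + 1) → ℝ => k 0)
      (ContinuousLinearMap.proj (R := ℝ) (φ := fun _ : Fin (n + 1) => ℝ) 0) 0 :=
      hasFDerivAt_apply 0 0
    exact congrArg (fun L => L v) ((hcomp 0).unique h1)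
  have hLs : ∀ v (i : Fin n), fderiv ℝ g 0 v i.succ =
      fderiv ℝ (fderiv ℝ f) 0 v (Pi.single i.succ 1) := fun v i => by
    have h1 : HasFDerivAt (partialD i.succ f) (fderiv ℝ (partialD i.succ f) 0) 0 :=
      ((contDiff_partialD hf i.succ).differentiable (by simp) 0).hasFDerivAt
    have h2 := congrArg (fun L => L v) ((hcomp i.succ).unique h1)
    exact h2.trans (fderiv_partialD hf _ _ _)
  have hinj : Function.Injective (fderiv ℝ g 0).toLinearMap := by
    refine (injective_iff_map_eq_zero _).2 fun v hv => ?_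
    have hv' : ∀ i, fderiv ℝ g 0 v i = 0 := fun i => congrFun hv i
    exact hk.eq_zero hf ((hL0 v).symm.trans (hv' 0)) fun i => (hLs v i).symm.trans (hv' i.succ)
  let e := (LinearEquiv.ofInjectiveEndo _ hinj).toContinuousLinearEquiv
  have he : (e : (Fin (n + 1) → ℝ) →L[ℝ] Fin (n + 1) → ℝ) = fderiv ℝ g 0 := by
    ext v
    rfl
  obtain ⟨φ, h0, -, hφ, -, hsymm⟩ := exists_smooth_openPartialHomeomorph (x₀ := 0)
    (Eventually.of_forall fun x => hg.contDiffAt) e (by rw [he]; exact hL) univ_mem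
  have hφ0 : φ 0 = 0 := by
    rw [hφ]
    funext i
    refine Fin.cases rfl (fun i => ?_) i
    simp [g, partialD, hk.1]
  have h0t : (0 : Fin (n + 1) → ℝ) ∈ φ.target := hφ0 ▸ φ.map_source h0
  let ι : ℝ → Fin (n + 1) → ℝ := fun y => Pi.single 0 y
  have hι : ContDiff ℝ ∞ ι := contDiff_pi.2 fun i =>
    Fin.cases (by simpa [ι] using contDiff_fun_id) (fun i => by simpa [ι] using contDiff_const) i
  have hιt : ∀ᶠ y in 𝓝 (0 : ℝ), ι y ∈ φ.target :=
    hι.continuous.continuousAt.eventually_mem (by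
      simpa [ι] using φ.open_target.mem_nhds h0t)
  obtain ⟨ζ, hζ, hζφ⟩ := exists_contDiff_eventuallyEq (x₀ := (0 : ℝ))
    (g := fun y => fun i : Fin n => φ.symm (ι y) i.succ) (by
      filter_upwards [hιt] with y hy
      refine contDiffAt_pi.2 fun i => ?_
      exact (contDiff_apply ℝ ℝ i.succ).contDiffAt.comp y
        ((hsymm.contDiffAt (φ.open_target.mem_nhds hy)).comp y hι.contDiffAt))
  refine ⟨ζ, hf, hk, hζ, ?_, ?_⟩
  · have : φ.symm (ι 0) = 0 := by
      have := φ.left_inv h0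
      rw [hφ0] at this
      simpa [ι] using this
    rw [hζφ.self_of_nhds]
    funext i
    simp [this]
  · filter_upwards [hιt, hζφ] with y hy hζy i
    have hr : g (φ.symm (ι y)) = ι y := by rw [← hφ]; exact φ.right_inv hy
    have hgr : graphCurve ζ y = φ.symm (ι y) := by
      funext j
      refine Fin.cases ?_ (fun j => ?_) j
      · have := congrFun hr 0
        simpa [g, ι, graphCurve] using this.symm
      · simp [graphCurve, hζy]
    rw [hgr]
    simpa [g, ι] using congrFun hr i.succ

lemma contDiff_graphCurve {ζ : ℝ → Fin n → ℝ} (hζ : ContDiff ℝ ∞ ζ) :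
    ContDiff ℝ ∞ (graphCurve ζ) :=
  contDiff_pi.2 fun i => Fin.cases contDiff_id (fun i => contDiff_pi.1 hζ i) i

/-- The derivatives at `0` of `∂^α f` along the curve `y ↦ (y, ζ(y))`. -/
noncomputable def curveD (f : (Fin (n + 1) → ℝ) → ℝ) (ζ : ℝ → Fin n → ℝ) (m : ℕ)
    (α : Fin (n + 1) → ℕ) : ℝ :=
  iteratedDeriv m (fun y => multiD α f (graphCurve ζ y)) 0

/-- The derivatives at `0` of the components of `ζ`. -/
noncomputable def sectionD (ζ : ℝ → Fin n → ℝ) (m : ℕ) (i : Fin n) : ℝ :=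
  iteratedDeriv m (fun y => ζ y i) 0

lemma hasDerivAt_comp_graphCurve {G : (Fin (n + 1) → ℝ) → ℝ} {ζ : ℝ → Fin n → ℝ}
    (hG : ContDiff ℝ ∞ G) (hζ : ContDiff ℝ ∞ ζ) (y : ℝ) :
    HasDerivAt (fun y => G (graphCurve ζ y)) (partialD 0 G (graphCurve ζ y) +
      ∑ i : Fin n, partialD i.succ G (graphCurve ζ y) * deriv (fun y => ζ y i) y) y := by
  have hγ : HasDerivAt (graphCurve ζ) (Fin.cons 1 fun i => deriv (fun y => ζ y i) y) y := by
    refine hasDerivAt_pi.2 fun i => ?_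
    refine Fin.cases ?_ (fun i => ?_) i
    · exact hasDerivAt_id y
    · exact ((contDiff_pi.1 hζ i).differentiable (by simp) y).hasDerivAt
  refine ((hG.differentiable (by simp) _).hasFDerivAt.comp_hasDerivAt y hγ).congr_deriv ?_
  rw [clm_apply_eq_sum, Fin.sum_univ_succ]
  simp [partialD, mul_comm]

namespace IsCriticalSection

variable {f : (Fin (n + 1) → ℝ) → ℝ} {ζ : ℝ → Fin n → ℝ}

lemma graphCurve_zero (h : IsCriticalSection f ζ) : graphCurve ζ 0 = 0 := by
  funext i
  refine Fin.cases rfl (fun i => ?_) i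
  simp [graphCurve, h.section_zero]

lemma curveD_zero (h : IsCriticalSection f ζ) (α : Fin (n + 1) → ℕ) :
    curveD f ζ 0 α = multiD α f 0 := by
  simp [curveD, h.graphCurve_zero]

lemma sectionD_zero (h : IsCriticalSection f ζ) (i : Fin n) : sectionD ζ 0 i = 0 := by
  simp [sectionD, h.section_zero]

/-- The chain rule and the Leibniz rule express `curveD` recursively through itself and the
derivatives of `ζ`. -/
lemma curveD_succ (h : IsCriticalSection f ζ) (m : ℕ) (α : Fin (n + 1) → ℕ) :
    curveD f ζ (m + 1) α = curveD f ζ m (α + Pi.single 0 1) +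
      ∑ i : Fin n, ∑ k ∈ Finset.range (m + 1), (m.choose k : ℝ) *
        curveD f ζ k (α + Pi.single i.succ 1) * sectionD ζ (m - k + 1) i := by
  have hG := contDiff_multiD h.contDiff α
  have hγ := contDiff_graphCurve h.contDiff_section
  have hcurve : ∀ i : Fin (n + 1), ContDiff ℝ ∞ fun y =>
      multiD (α + Pi.single i 1) f (graphCurve ζ y) := fun i =>
    (contDiff_multiD h.contDiff _).comp hγ
  have hsec : ∀ i : Fin n, ContDiff ℝ ∞ (deriv fun y => ζ y i) := fun i =>
    ((contDiff_succ_iff_deriv (n := ∞)).1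
      (by simpa using contDiff_pi.1 h.contDiff_section i)).2.2
  have hd : deriv (fun y => multiD α f (graphCurve ζ y)) = fun y =>
      multiD (α + Pi.single 0 1) f (graphCurve ζ y) + ∑ i : Fin n,
        multiD (α + Pi.single i.succ 1) f (graphCurve ζ y) * deriv (fun y => ζ y i) y := by
    funext y
    rw [(hasDerivAt_comp_graphCurve hG h.contDiff_section y).deriv]
    simp_rw [partialD_multiD h.contDiff]
  have hmul : ∀ i : Fin n, ContDiff ℝ ∞ fun y =>
      multiD (α + Pi.single i.succ 1) f (graphCurve ζ y) * deriv (fun y => ζ y i) y :=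
    fun i => (hcurve i.succ).mul (hsec i)
  rw [curveD, iteratedDeriv_succ', hd, iteratedDeriv_fun_add
    (contDiff_infty.1 (hcurve 0) m).contDiffAt
    (contDiff_infty.1 (ContDiff.sum fun i _ => hmul i) m).contDiffAt,
    iteratedDeriv_fun_sum fun i _ => (contDiff_infty.1 (hmul i) m).contDiffAt]
  congr 1
  refine Finset.sum_congr rfl fun i _ => ?_
  rw [iteratedDeriv_fun_mul (contDiff_infty.1 (hcurve i.succ) m).contDiffAt
    (contDiff_infty.1 (hsec i) m).contDiffAt]
  simp_rw [sectionD, iteratedDeriv_succ']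
  rfl

/-- Along the curve `y ↦ (y, ζ(y))` the derivatives `f_z` vanish identically near `0`. -/
lemma curveD_single_succ (h : IsCriticalSection f ζ) (m : ℕ) (i : Fin n) :
    curveD f ζ m (Pi.single i.succ 1) = 0 := by
  have : (fun y => multiD (Pi.single i.succ 1) f (graphCurve ζ y)) =ᶠ[𝓝 0] fun _ => 0 := by
    filter_upwards [h.critical] with y hy
    rw [multiD_single h.contDiff, hy]
  rw [curveD, this.iteratedDeriv_eq]
  simp

lemma hess_mulVec_sectionD_one (h : IsCriticalSection f ζ) : hess f *ᵥ sectionD ζ 1 = 0 := by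
  funext i
  have := h.curveD_succ 0 (Pi.single i.succ 1)
  simp only [h.curveD_single_succ, h.curveD_zero, add_comm (Pi.single i.succ 1) (Pi.single 0 1),
    h.kernel.multiD_zero_add_single h.contDiff] at this
  simpa [Matrix.mulVec, dotProduct, hess, h.curveD_zero] using this.symm

/-- Solving a linear system with the matrix `f_{z²}`. -/
lemma eq_neg_invHess_mulVec (h : IsCriticalSection f ζ) {v w : Fin n → ℝ}
    (hvw : hess f *ᵥ v + w = 0) : v = -(invHess f *ᵥ w) := by
  have : v = invHess f *ᵥ (hess f *ᵥ v) := by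
    rw [Matrix.mulVec_mulVec, h.kernel.invHess_mul_hess h.contDiff, Matrix.one_mulVec]
  rw [this, eq_neg_of_add_eq_zero_left hvw, Matrix.mulVec_neg]

lemma sectionD_one (h : IsCriticalSection f ζ) (i : Fin n) : sectionD ζ 1 i = 0 := by
  have := h.eq_neg_invHess_mulVec (v := sectionD ζ 1) (w := 0)
    (by rw [h.hess_mulVec_sectionD_one, add_zero])
  rw [this]
  simp

/-- The recursion `curveD_succ`, simplified by `ζ'(0) = 0`. -/
lemma curveD_succ' (h : IsCriticalSection f ζ) (m : ℕ) (α : Fin (n + 1) → ℕ) :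
    curveD f ζ (m + 1) α = curveD f ζ m (α + Pi.single 0 1) +
      ∑ i : Fin n, ∑ k ∈ Finset.range m, (m.choose k : ℝ) *
        curveD f ζ k (α + Pi.single i.succ 1) * sectionD ζ (m - k + 1) i := by
  rw [h.curveD_succ]
  simp [Finset.sum_range_succ, h.sectionD_one]

/-- Differentiating `f_z(y, ζ(y)) = 0` shows how the derivatives of `ζ` are determined. -/
lemma sectionD_eq (h : IsCriticalSection f ζ) (m : ℕ) :
    sectionD ζ (m + 2) = -(invHess f *ᵥ fun i =>
      curveD f ζ (m + 1) (Pi.single i.succ 1 + Pi.single 0 1) +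
      ∑ l : Fin n, ∑ k ∈ Finset.range m, ((m + 1).choose (k + 1) : ℝ) *
        curveD f ζ (k + 1) (Pi.single i.succ 1 + Pi.single l.succ 1) *
          sectionD ζ (m - k + 1) l) := by
  refine h.eq_neg_invHess_mulVec (funext fun i => ?_)
  have := h.curveD_succ' (m + 1) (Pi.single i.succ 1)
  rw [h.curveD_single_succ] at this
  simp only [Finset.sum_range_succ', Finset.sum_add_distrib, h.curveD_zero] at this
  simp only [Pi.add_apply, Matrix.mulVec, dotProduct, hess, Matrix.of_apply, Pi.zero_apply]
  simp only [Nat.choose_zero_right, Nat.cast_one, one_mul, Nat.sub_zero,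
    Nat.add_sub_add_right] at this
  rw [this]
  ring

/-- The derivatives of `f` along the curve `y ↦ (y, ζ(y))` are those of `f_y` along this curve,
since `f_z` vanishes there. -/
lemma curveD_succ_zero (h : IsCriticalSection f ζ) (m : ℕ) :
    curveD f ζ (m + 1) 0 = curveD f ζ m (Pi.single 0 1) := by
  rw [h.curveD_succ]
  simp [h.curveD_single_succ]

end IsCriticalSection

end CriticalSection

/-! ### The coefficients as universal polynomials -/

section Polynomials

variable (n : ℕ)

/-- The pairs of an admissible function `f` and a solution `ζ` of `f_z(y, ζ(y)) = 0`. -/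
abbrev CriticalPair : Type :=
  {p : ((Fin (n + 1) → ℝ) → ℝ) × (ℝ → Fin n → ℝ) // IsCriticalSection p.1 p.2}

/-- The quantities attached to `f` and `ζ` that are values of one integer polynomial without
constant term in the mixed derivatives of `f` of orders `3, …, M` and the entries of `f_{z²}⁻¹`. -/
def polynomialQuantities (M : ℕ) : NonUnitalSubring (CriticalPair n → ℝ) where
  carrier := {Φ | ∃ p : MvPolynomial (MixedIndex n M ⊕ Fin n × Fin n) ℤ,
    MvPolynomial.constantCoeff p = 0 ∧ ∀ a : CriticalPair n, Φ a = MvPolynomial.aeval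
      (Sum.elim (fun α : MixedIndex n M => multiD α.1 a.1.1 0)
        (fun q => invHess a.1.1 q.1 q.2)) p}
  zero_mem' := ⟨0, by simp, by simp⟩
  add_mem' := by
    rintro Φ Ψ ⟨p, hp, hΦ⟩ ⟨q, hq, hΨ⟩
    exact ⟨p + q, by simp [hp, hq], fun a => by simp [hΦ, hΨ]⟩
  mul_mem' := by
    rintro Φ Ψ ⟨p, hp, hΦ⟩ ⟨q, hq, hΨ⟩
    exact ⟨p * q, by simp [hp], fun a => by simp [hΦ, hΨ]⟩
  neg_mem' := by
    rintro Φ ⟨p, hp, hΦ⟩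
    exact ⟨-p, by simp [hp], fun a => by simp [hΦ]⟩

variable {n} {M : ℕ}

lemma multiD_mem_polynomialQuantities {α : Fin (n + 1) → ℕ} (h3 : 3 ≤ ∑ i, α i)
    (hM : ∑ i, α i ≤ M) (hα : ∃ i : Fin n, α i.succ ≠ 0) :
    (fun a => multiD α a.1.1 0) ∈ polynomialQuantities n M :=
  by
  refine ⟨MvPolynomial.X (Sum.inl ⟨α, h3, hM, hα⟩), by simp, fun a => ?_⟩
  rw [MvPolynomial.aeval_X]
  rfl

lemma invHess_mem_polynomialQuantities (i j : Fin n) :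
    (fun a => invHess a.1.1 i j) ∈ polynomialQuantities n M :=
  by
  refine ⟨MvPolynomial.X (Sum.inr (i, j)), by simp, fun a => ?_⟩
  rw [MvPolynomial.aeval_X]
  rfl

lemma natCast_mul_mem_polynomialQuantities {Φ : CriticalPair n → ℝ}
    (hΦ : Φ ∈ polynomialQuantities n M) (c : ℕ) :
    (fun a => (c : ℝ) * Φ a) ∈ polynomialQuantities n M := by
  have := nsmul_mem hΦ c
  have h : (fun a => (c : ℝ) * Φ a) = c • Φ := by
    funext a
    simp
  rwa [h]

lemma sum_mem_polynomialQuantities {ι : Type*} (s : Finset ι) {Φ : ι → CriticalPair n → ℝ}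
    (hΦ : ∀ i ∈ s, Φ i ∈ polynomialQuantities n M) :
    (fun a => ∑ i ∈ s, Φ i a) ∈ polynomialQuantities n M := by
  have := sum_mem hΦ
  have h : (fun a => ∑ i ∈ s, Φ i a) = ∑ i ∈ s, Φ i := by
    funext a
    simp
  rwa [h]

lemma sum_add_single (α : Fin (n + 1) → ℕ) (i : Fin (n + 1)) (k : ℕ) :
    ∑ j, (α + Pi.single i k : Fin (n + 1) → ℕ) j = ∑ j, α j + k := by
  simp [Finset.sum_add_distrib]

/-- Unrolling `curveD_succ'` never raises `|α| + m`, and preserves the presence of a transversal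
derivative. The hypotheses `2 ≤ |α|` and `3 ≤ |α| + m` keep the derivatives of order `2`, which are
not among the variables, from appearing. -/
lemma curveD_mem_polynomialQuantities {m : ℕ} {α : Fin (n + 1) → ℕ}
    (hα : ∃ i : Fin n, α i.succ ≠ 0) (h2 : 2 ≤ ∑ i, α i) (h3 : 3 ≤ ∑ i, α i + m)
    (hM : ∑ i, α i + m ≤ M)
    (hs : ∀ j ≤ m, ∀ i, (fun a => sectionD a.1.2 j i) ∈ polynomialQuantities n M) :
    (fun a => curveD a.1.1 a.1.2 m α) ∈ polynomialQuantities n M := by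
  induction m using Nat.strong_induction_on generalizing α with
  | _ m ih =>
  cases m with
  | zero =>
    simp_rw [fun a : CriticalPair n => a.2.curveD_zero]
    exact multiD_mem_polynomialQuantities h3 hM hα
  | succ m =>
    obtain ⟨l, hl⟩ := hα
    have hmixed : ∀ i, ∃ l : Fin n, (α + Pi.single i 1 : Fin (n + 1) → ℕ) l.succ ≠ 0 :=
      fun i => ⟨l, by simp [hl]⟩
    simp_rw [fun a : CriticalPair n => a.2.curveD_succ']
    refine add_mem (ih m (by omega) (hmixed 0) ?_ ?_ ?_ fun j hj => hs j (by omega))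
      (sum_mem_polynomialQuantities _ fun i _ => sum_mem_polynomialQuantities _ fun k hk => ?_)
    · rw [sum_add_single]; omega
    · rw [sum_add_single]; omega
    · rw [sum_add_single]; omega
    · rw [Finset.mem_range] at hk
      refine mul_mem (natCast_mul_mem_polynomialQuantities
        (ih k (by omega) (hmixed i.succ) ?_ ?_ ?_ fun j hj => hs j (by omega)) _)
        (hs _ (by omega) i)
      · rw [sum_add_single]; omega
      · rw [sum_add_single]; omega
      · rw [sum_add_single]; omega

/-- By `sectionD_eq`, the derivative of order `j` of `ζ` involves derivatives of `f` of orders up to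
`j + 1` only. -/
lemma sectionD_mem_polynomialQuantities {j : ℕ} (hj : j + 1 ≤ M) (i : Fin n) :
    (fun a => sectionD a.1.2 j i) ∈ polynomialQuantities n M := by
  induction j using Nat.strong_induction_on generalizing i with
  | _ j ih =>
  match j, hj, ih with
  | 0, _, _ =>
    simp_rw [fun a : CriticalPair n => a.2.sectionD_zero]
    exact zero_mem _
  | 1, _, _ =>
    simp_rw [fun a : CriticalPair n => a.2.sectionD_one]
    exact zero_mem _
  | m + 2, hj, ih =>
    simp_rw [fun a : CriticalPair n => a.2.sectionD_eq m]
    refine neg_mem (sum_mem_polynomialQuantities Finset.univ fun l _ =>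
      mul_mem (invHess_mem_polynomialQuantities i l) (add_mem ?_
        (sum_mem_polynomialQuantities _ fun q _ => sum_mem_polynomialQuantities _ fun k hk =>
          mul_mem (natCast_mul_mem_polynomialQuantities ?_ _) (ih _ ?_ ?_ _))))
    · refine curveD_mem_polynomialQuantities ⟨l, by simp⟩ ?_ ?_ ?_
        fun j hj' i => ih j (by omega) (by omega) i
      all_goals rw [sum_add_single]; simp; try omega
    · rw [Finset.mem_range] at hk
      refine curveD_mem_polynomialQuantities ⟨l, by simp⟩ ?_ ?_ ?_
        fun j hj' i => ih j (by omega) (by omega) i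
      all_goals rw [sum_add_single]; simp; try omega
    · omega
    · omega

/-- The only derivative of `f` of order `M + 1` that enters the derivatives of `f_y(y, ζ(y))` is the
pure one: the mixed ones come with the factor `ζ'(0) = 0`. -/
lemma curveD_sub_multiD_mem_polynomialQuantities {s m : ℕ} (hs : 1 ≤ s) (hM : s + m ≤ M + 1) :
    (fun a => curveD a.1.1 a.1.2 m (Pi.single 0 s) - multiD (Pi.single 0 (s + m)) a.1.1 0) ∈
      polynomialQuantities n M := by
  induction m generalizing s with
  | zero =>
    simp_rw [fun a : CriticalPair n => a.2.curveD_zero, add_zero, sub_self]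
    exact zero_mem _
  | succ m ih =>
    have hsingle : (Pi.single 0 s + Pi.single 0 1 : Fin (n + 1) → ℕ) = Pi.single 0 (s + 1) := by
      rw [Pi.single_add]
    simp_rw [fun a : CriticalPair n => a.2.curveD_succ', add_sub_right_comm, hsingle,
      show s + (m + 1) = s + 1 + m by ring]
    refine add_mem (ih (by omega) (by omega)) (sum_mem_polynomialQuantities _ fun i _ =>
      sum_mem_polynomialQuantities _ fun k hk => ?_)
    rw [Finset.mem_range] at hk
    by_cases h : 2 ≤ s + k
    · refine mul_mem (natCast_mul_mem_polynomialQuantities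
        (curveD_mem_polynomialQuantities ⟨i, by simp⟩ ?_ ?_ ?_
          fun j hj i => sectionD_mem_polynomialQuantities (by omega) i) _)
        (sectionD_mem_polynomialQuantities (by omega) i)
      all_goals rw [sum_add_single]; simp; try omega
    · obtain ⟨rfl, rfl⟩ : s = 1 ∧ k = 0 := by omega
      -- here `∂²f(0)/∂k_1∂k_i = 0` kills the derivative of `ζ` of too high an order
      simp_rw [fun a : CriticalPair n => a.2.curveD_zero,
        fun a : CriticalPair n => a.2.kernel.multiD_zero_add_single a.2.contDiff]
      simp only [mul_zero, zero_mul]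
      exact zero_mem _

/-- The derivative of order `μ + 1` of `f(y, ζ(y))` has the required polynomial form. -/
lemma exists_polynomial_coeffA (n μ : ℕ) :
    ∃ p : MvPolynomial (MixedIndex n μ ⊕ Fin n × Fin n) ℤ, MvPolynomial.constantCoeff p = 0 ∧
      ∀ f ζ, IsCriticalSection f ζ → coeffA p f = curveD f ζ μ (Pi.single 0 1) := by
  obtain ⟨p, hp, hval⟩ :=
    curveD_sub_multiD_mem_polynomialQuantities (n := n) (M := μ) (le_refl 1) (add_comm 1 μ).le
  refine ⟨p, hp, fun f ζ h => ?_⟩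
  have := hval ⟨(f, ζ), h⟩
  rw [coeffA, ← this, add_comm μ 1]
  ring

end Polynomials

/-! ### The coefficients of low order -/

section Tables

variable {n : ℕ} {f : (Fin (n + 1) → ℝ) → ℝ} {ζ : ℝ → Fin n → ℝ}

lemma hess_eq (f : (Fin (n + 1) → ℝ) → ℝ) : hess f = Matrix.of fun i j =>
    multiD (Pi.single 0 0 + (Pi.single i.succ 1 + Pi.single j.succ 1)) f 0 := by
  simp [hess]

lemma fYZZ_eq (f : (Fin (n + 1) → ℝ) → ℝ) (m : ℕ) : fYZZ f m = Matrix.of fun i j =>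
    multiD (Pi.single 0 m + (Pi.single i.succ 1 + Pi.single j.succ 1)) f 0 := by
  simp [fYZZ, add_assoc]

lemma fYZZ_transpose (f : (Fin (n + 1) → ℝ) → ℝ) (m : ℕ) : (fYZZ f m)ᵀ = fYZZ f m := by
  ext i j
  simp [fYZZ_eq, add_comm (Pi.single i.succ 1)]

lemma invHess_transpose (hf : ContDiff ℝ ∞ f) : (invHess f)ᵀ = invHess f := by
  change ((hess f)⁻¹)ᵀ = (hess f)⁻¹
  rw [Matrix.transpose_nonsing_inv, hess_transpose hf]

/-- The vector with the components `∑ f_{z_i z_j z_l} v_j v_l`. -/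
noncomputable def fZZZVec (f : (Fin (n + 1) → ℝ) → ℝ) (v : Fin n → ℝ) : Fin n → ℝ := fun i =>
  ∑ j : Fin n, (∑ l : Fin n,
    multiD (Pi.single i.succ 1 + Pi.single j.succ 1 + Pi.single l.succ 1) f 0 * v l) * v j

lemma dotProduct_fZZZVec (f : (Fin (n + 1) → ℝ) → ℝ) (v : Fin n → ℝ) :
    v ⬝ᵥ fZZZVec f v = fZZZ f v := by
  simp only [dotProduct, fZZZVec, fZZZ, Finset.mul_sum, Finset.sum_mul]
  refine Finset.sum_congr rfl fun i _ => Finset.sum_congr rfl fun j _ =>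
    Finset.sum_congr rfl fun l _ => ?_
  ring

lemma fZZZVec_neg (f : (Fin (n + 1) → ℝ) → ℝ) (v : Fin n → ℝ) :
    fZZZVec f (-v) = fZZZVec f v := by
  funext i
  simp [fZZZVec]

lemma dotProduct_mulVec_comm {A : Matrix (Fin n) (Fin n) ℝ} (hA : Aᵀ = A) (v w : Fin n → ℝ) :
    v ⬝ᵥ (A *ᵥ w) = (A *ᵥ v) ⬝ᵥ w := by
  rw [Matrix.dotProduct_mulVec, ← Matrix.mulVec_transpose, hA]

namespace IsCriticalSection

/-- The recursion `curveD_succ'` with the order of differentiation in `y` made explicit. -/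
lemma curveD_succ_single_add (h : IsCriticalSection f ζ) (m a : ℕ) (β : Fin (n + 1) → ℕ) :
    curveD f ζ (m + 1) (Pi.single 0 a + β) = curveD f ζ m (Pi.single 0 (a + 1) + β) +
      ∑ i : Fin n, ∑ k ∈ Finset.range m, (m.choose k : ℝ) *
        curveD f ζ k (Pi.single 0 a + (β + Pi.single i.succ 1)) * sectionD ζ (m - k + 1) i := by
  rw [h.curveD_succ']
  simp_rw [Pi.single_add, add_assoc, add_comm β (Pi.single 0 1)]

lemma curveD_one (h : IsCriticalSection f ζ) (a : ℕ) (β : Fin (n + 1) → ℕ) :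
    curveD f ζ 1 (Pi.single 0 a + β) = multiD (Pi.single 0 (a + 1) + β) f 0 := by
  simp [h.curveD_succ_single_add, h.curveD_zero]

lemma curveD_two (h : IsCriticalSection f ζ) (a : ℕ) (β : Fin (n + 1) → ℕ) :
    curveD f ζ 2 (Pi.single 0 a + β) = multiD (Pi.single 0 (a + 2) + β) f 0 +
      ∑ i : Fin n, multiD (Pi.single 0 a + (β + Pi.single i.succ 1)) f 0 * sectionD ζ 2 i := by
  simp [h.curveD_succ_single_add, h.curveD_zero]

lemma curveD_three (h : IsCriticalSection f ζ) (a : ℕ) (β : Fin (n + 1) → ℕ) :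
    curveD f ζ 3 (Pi.single 0 a + β) = multiD (Pi.single 0 (a + 3) + β) f 0 +
      3 * ∑ i : Fin n,
        multiD (Pi.single 0 (a + 1) + (β + Pi.single i.succ 1)) f 0 * sectionD ζ 2 i +
      ∑ i : Fin n, multiD (Pi.single 0 a + (β + Pi.single i.succ 1)) f 0 * sectionD ζ 3 i := by
  rw [h.curveD_succ_single_add, h.curveD_two]
  simp only [Finset.sum_range_succ, Finset.sum_range_zero, h.curveD_zero, h.curveD_one,
    Finset.sum_add_distrib, mul_assoc, ← Finset.mul_sum]
  norm_num
  ring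

lemma curveD_four (h : IsCriticalSection f ζ) (a : ℕ) (β : Fin (n + 1) → ℕ) :
    curveD f ζ 4 (Pi.single 0 a + β) = multiD (Pi.single 0 (a + 4) + β) f 0 +
      6 * ∑ i : Fin n,
        multiD (Pi.single 0 (a + 2) + (β + Pi.single i.succ 1)) f 0 * sectionD ζ 2 i +
      4 * ∑ i : Fin n,
        multiD (Pi.single 0 (a + 1) + (β + Pi.single i.succ 1)) f 0 * sectionD ζ 3 i +
      ∑ i : Fin n, multiD (Pi.single 0 a + (β + Pi.single i.succ 1)) f 0 * sectionD ζ 4 i +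
      3 * ∑ i : Fin n, (∑ j : Fin n,
        multiD (Pi.single 0 a + (β + Pi.single i.succ 1 + Pi.single j.succ 1)) f 0 *
          sectionD ζ 2 j) * sectionD ζ 2 i := by
  rw [h.curveD_succ_single_add, h.curveD_three]
  simp only [Finset.sum_range_succ, Finset.sum_range_zero, h.curveD_zero, h.curveD_one,
    h.curveD_two, add_mul, mul_add, Finset.sum_add_distrib, mul_assoc, ← Finset.mul_sum]
  norm_num [Nat.choose]
  ring

lemma curveD_five (h : IsCriticalSection f ζ) (a : ℕ) (β : Fin (n + 1) → ℕ) :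
    curveD f ζ 5 (Pi.single 0 a + β) = multiD (Pi.single 0 (a + 5) + β) f 0 +
      10 * ∑ i : Fin n,
        multiD (Pi.single 0 (a + 3) + (β + Pi.single i.succ 1)) f 0 * sectionD ζ 2 i +
      10 * ∑ i : Fin n,
        multiD (Pi.single 0 (a + 2) + (β + Pi.single i.succ 1)) f 0 * sectionD ζ 3 i +
      5 * ∑ i : Fin n,
        multiD (Pi.single 0 (a + 1) + (β + Pi.single i.succ 1)) f 0 * sectionD ζ 4 i +
      ∑ i : Fin n, multiD (Pi.single 0 a + (β + Pi.single i.succ 1)) f 0 * sectionD ζ 5 i +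
      15 * ∑ i : Fin n, (∑ j : Fin n,
        multiD (Pi.single 0 (a + 1) + (β + Pi.single i.succ 1 + Pi.single j.succ 1)) f 0 *
          sectionD ζ 2 j) * sectionD ζ 2 i +
      6 * ∑ i : Fin n, (∑ j : Fin n,
        multiD (Pi.single 0 a + (β + Pi.single i.succ 1 + Pi.single j.succ 1)) f 0 *
          sectionD ζ 2 j) * sectionD ζ 3 i +
      4 * ∑ i : Fin n, (∑ j : Fin n,
        multiD (Pi.single 0 a + (β + Pi.single i.succ 1 + Pi.single j.succ 1)) f 0 *
          sectionD ζ 3 j) * sectionD ζ 2 i := by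
  rw [h.curveD_succ_single_add, h.curveD_four]
  simp only [Finset.sum_range_succ, Finset.sum_range_zero, h.curveD_zero, h.curveD_one,
    h.curveD_two, h.curveD_three, add_mul, mul_add, Finset.sum_add_distrib, mul_assoc,
    ← Finset.mul_sum]
  norm_num [Nat.choose]
  ring

lemma sectionD_two (h : IsCriticalSection f ζ) :
    sectionD ζ 2 = -(invHess f *ᵥ fYZ f 2) := by
  refine h.eq_neg_invHess_mulVec (funext fun i => ?_)
  have := h.curveD_two 0 (Pi.single i.succ 1)
  rw [Pi.single_zero, zero_add, h.curveD_single_succ] at this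
  simp [hess_eq, Matrix.mulVec, dotProduct, fYZ]
  simp at this
  linarith

lemma sectionD_three (h : IsCriticalSection f ζ) :
    sectionD ζ 3 = -(invHess f *ᵥ (fYZ f 3 + (3 : ℝ) • (fYZZ f 1 *ᵥ sectionD ζ 2))) := by
  refine h.eq_neg_invHess_mulVec (funext fun i => ?_)
  have := h.curveD_three 0 (Pi.single i.succ 1)
  rw [Pi.single_zero, zero_add, h.curveD_single_succ] at this
  simp [hess_eq, Matrix.mulVec, dotProduct, fYZ, fYZZ_eq]
  simp at this
  linarith

lemma sectionD_four (h : IsCriticalSection f ζ) :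
    sectionD ζ 4 = -(invHess f *ᵥ (fYZ f 4 + (6 : ℝ) • (fYZZ f 2 *ᵥ sectionD ζ 2) +
      (4 : ℝ) • (fYZZ f 1 *ᵥ sectionD ζ 3) + (3 : ℝ) • fZZZVec f (sectionD ζ 2))) := by
  refine h.eq_neg_invHess_mulVec (funext fun i => ?_)
  have := h.curveD_four 0 (Pi.single i.succ 1)
  rw [Pi.single_zero, zero_add, h.curveD_single_succ] at this
  simp [hess_eq, Matrix.mulVec, dotProduct, fYZ, fYZZ_eq, fZZZVec]
  simp at this
  linarith

lemma fYZ_one (h : IsCriticalSection f ζ) : fYZ f 1 = 0 :=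
  funext fun i => h.kernel.multiD_zero_add_single h.contDiff i.succ

lemma curveD_two_eq_tableA2 (h : IsCriticalSection f ζ) :
    curveD f ζ 2 (Pi.single 0 1) = tableA2 f := by
  have := h.curveD_two 1 0
  have h1 : ∀ i : Fin n, multiD (Pi.single 0 1 + Pi.single i.succ 1) f 0 = 0 := fun i =>
    congrFun h.fYZ_one i
  simpa [h1, tableA2, fY] using this

lemma curveD_three_eq_tableA3 (h : IsCriticalSection f ζ) :
    curveD f ζ 3 (Pi.single 0 1) = tableA3 f := by
  have hD : curveD f ζ 3 (Pi.single 0 1) = fY f 4 + 3 * (fYZ f 2 ⬝ᵥ sectionD ζ 2) +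
      fYZ f 1 ⬝ᵥ sectionD ζ 3 := by
    simpa [fYZ, fY, dotProduct] using h.curveD_three 1 0
  rw [hD, h.fYZ_one, h.sectionD_two, tableA3]
  simp
  ring

lemma curveD_four_eq_tableA4 (h : IsCriticalSection f ζ) :
    curveD f ζ 4 (Pi.single 0 1) = tableA4 f := by
  have hD : curveD f ζ 4 (Pi.single 0 1) = fY f 5 + 6 * (fYZ f 3 ⬝ᵥ sectionD ζ 2) +
      4 * (fYZ f 2 ⬝ᵥ sectionD ζ 3) + fYZ f 1 ⬝ᵥ sectionD ζ 4 +
        3 * (sectionD ζ 2 ⬝ᵥ (fYZZ f 1 *ᵥ sectionD ζ 2)) := by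
    have := h.curveD_four 1 0
    simp only [add_zero, zero_add] at this
    rw [this]
    simp [fYZ, fY, fYZZ_eq, dotProduct, Matrix.mulVec, mul_comm]
  have hA := dotProduct_mulVec_comm (invHess_transpose h.contDiff)
  rw [hD, h.fYZ_one, h.sectionD_three, h.sectionD_two, tableA4]
  simp only [Matrix.mulVec_add, Matrix.mulVec_sub, Matrix.mulVec_neg, Matrix.mulVec_smul,
    dotProduct_add, dotProduct_sub, dotProduct_neg, dotProduct_smul, neg_dotProduct,
    zero_dotProduct, smul_eq_mul, hA (fYZ f 2), dotProduct_comm (fYZ f 3)]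
  ring

lemma curveD_five_eq_tableA5 (h : IsCriticalSection f ζ) :
    curveD f ζ 5 (Pi.single 0 1) = tableA5 f := by
  have hA := dotProduct_mulVec_comm (invHess_transpose h.contDiff)
  have hB := dotProduct_mulVec_comm (fYZZ_transpose f 1)
  have hD : curveD f ζ 5 (Pi.single 0 1) = fY f 6 + 10 * (fYZ f 4 ⬝ᵥ sectionD ζ 2) +
      10 * (fYZ f 3 ⬝ᵥ sectionD ζ 3) + 5 * (fYZ f 2 ⬝ᵥ sectionD ζ 4) +
        fYZ f 1 ⬝ᵥ sectionD ζ 5 + 15 * (sectionD ζ 2 ⬝ᵥ (fYZZ f 2 *ᵥ sectionD ζ 2)) +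
        6 * (sectionD ζ 3 ⬝ᵥ (fYZZ f 1 *ᵥ sectionD ζ 2)) +
        4 * (sectionD ζ 2 ⬝ᵥ (fYZZ f 1 *ᵥ sectionD ζ 3)) := by
    have := h.curveD_five 1 0
    simp only [add_zero, zero_add] at this
    rw [this]
    simp [fYZ, fY, fYZZ_eq, dotProduct, Matrix.mulVec, mul_comm]
  have hu : sectionD ζ 3 ⬝ᵥ (fYZZ f 1 *ᵥ sectionD ζ 2) =
      sectionD ζ 2 ⬝ᵥ (fYZZ f 1 *ᵥ sectionD ζ 3) := by
    rw [hB, dotProduct_comm]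
  have h3 : fYZ f 3 ⬝ᵥ (invHess f *ᵥ (fYZZ f 1 *ᵥ (invHess f *ᵥ fYZ f 2))) =
      (invHess f *ᵥ fYZ f 2) ⬝ᵥ (fYZZ f 1 *ᵥ (invHess f *ᵥ fYZ f 3)) := by
    rw [hA, hB, dotProduct_comm]
  rw [hD, hu, h.fYZ_one, h.sectionD_four, h.sectionD_three, h.sectionD_two, fZZZVec_neg, tableA5]
  simp only [Matrix.mulVec_add, Matrix.mulVec_sub, Matrix.mulVec_neg, Matrix.mulVec_smul,
    dotProduct_add, dotProduct_sub, dotProduct_neg, dotProduct_smul, neg_dotProduct,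
    zero_dotProduct, smul_eq_mul, h3, hA (fYZ f 2), dotProduct_comm (fYZ f 4),
    dotProduct_fZZZVec]
  ring

end IsCriticalSection

end Tables

/-! ### Elimination of the transversal variables -/

section MatrixSqrt

attribute [local instance] Matrix.linftyOpNormedRing Matrix.linftyOpNormedAlgebra

/-- A smooth family of symmetric matrices is, near a point where it is nonsingular, congruent to a
constant matrix by a smooth family of transition matrices. The transition matrix is the square root
of `(M 0)⁻¹ * M k`; the symmetry of `M k` makes it self-adjoint with respect to `M 0`. -/
lemma exists_smooth_congruence {n : ℕ} {E : Type} [NormedAddCommGroup E] [NormedSpace ℝ E]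
    {M : E → Matrix (Fin n) (Fin n) ℝ} (hM : ∀ i j, ContDiff ℝ ∞ fun k => M k i j)
    (hsymm : ∀ k, (M k)ᵀ = M k) (hdet : IsUnit (M 0).det) :
    ∃ B : E → Matrix (Fin n) (Fin n) ℝ, (∀ i j, ContDiff ℝ ∞ fun k => B k i j) ∧ B 0 = 1 ∧
      ∀ᶠ k in 𝓝 0, (B k)ᵀ * M 0 * B k = M k := by
  obtain ⟨S, hS, hS1, hsq, hτ⟩ := exists_smooth_sqrt (Matrix (Fin n) (Fin n) ℝ)
  have hMc : ContDiff ℝ ∞ M := by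
    have : M = fun k => ∑ i, ∑ j, M k i j • Matrix.single i j (1 : ℝ) := by
      funext k
      conv_lhs => rw [Matrix.matrix_eq_sum_single (M k)]
      simp [Matrix.smul_single]
    rw [this]
    exact ContDiff.sum fun i _ => ContDiff.sum fun j _ => (hM i j).smul contDiff_const
  let C : E → Matrix (Fin n) (Fin n) ℝ := fun k => (M 0)⁻¹ * M k
  have hC : ContDiff ℝ ∞ C := contDiff_const.mul hMc
  have hC0 : C 0 = 1 := Matrix.nonsing_inv_mul _ hdet
  have hC1 : Tendsto C (𝓝 0) (𝓝 1) := hC0 ▸ hC.continuous.tendsto 0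
  have hent : ∀ i j, ContDiff ℝ ∞ fun X : Matrix (Fin n) (Fin n) ℝ => X i j := fun i j =>
    (LinearMap.toContinuousLinearMap (Matrix.entryLinearMap ℝ ℝ i j)).contDiff
  refine ⟨fun k => S (C k), fun i j => (hent i j).comp (hS.comp hC), by simp only [hC0, hS1], ?_⟩
  have h1 := hC1.eventually hsq
  have h2 := hC1.eventually (hτ (fun X => (M 0)⁻¹ * Xᵀ * M 0) ?_ ?_ ?_)
  · filter_upwards [h1, h2] with k hk1 hk2
    have hfix : (M 0)⁻¹ * (C k)ᵀ * M 0 = C k := by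
      simp only [C, Matrix.transpose_mul, Matrix.transpose_nonsing_inv, hsymm]
      rw [Matrix.mul_assoc, Matrix.mul_assoc, Matrix.nonsing_inv_mul _ hdet, Matrix.mul_one]
    have hB := hk2 hfix
    have hB' : (S (C k))ᵀ * M 0 = M 0 * S (C k) := by
      conv_rhs => rw [← hB]
      rw [← Matrix.mul_assoc, ← Matrix.mul_assoc, Matrix.mul_nonsing_inv _ hdet, Matrix.one_mul]
    rw [hB', Matrix.mul_assoc, hk1]
    simp only [C]
    rw [← Matrix.mul_assoc, Matrix.mul_nonsing_inv _ hdet, Matrix.one_mul]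
  · fun_prop
  · simp [Matrix.nonsing_inv_mul _ hdet]
  · intro a b
    have : M 0 * (M 0)⁻¹ = 1 := Matrix.mul_nonsing_inv _ hdet
    calc (M 0)⁻¹ * (a * b)ᵀ * M 0 = (M 0)⁻¹ * bᵀ * 1 * aᵀ * M 0 := by
          simp [Matrix.transpose_mul, Matrix.mul_assoc]
      _ = _ := by rw [← this]; simp only [Matrix.mul_assoc]

end MatrixSqrt

section Remainder

variable {n : ℕ} {f : (Fin (n + 1) → ℝ) → ℝ} {ζ : ℝ → Fin n → ℝ}

/-- The coefficients of the quadratic remainder, in the transversal directions, of the Taylor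
expansion of `f` about the point `(y, ζ(y))` of the same first coordinate. -/
noncomputable def remainderMatrix (f : (Fin (n + 1) → ℝ) → ℝ) (ζ : ℝ → Fin n → ℝ)
    (k : Fin (n + 1) → ℝ) : Matrix (Fin n) (Fin n) ℝ :=
  Matrix.of fun i j => ∫ t in (0 : ℝ)..1, (1 - t) *
    fderiv ℝ (fderiv ℝ f) (graphCurve ζ (k 0) + t • (k - graphCurve ζ (k 0)))
      (Pi.single i.succ 1) (Pi.single j.succ 1)

namespace IsCriticalSection

lemma contDiff_remainderMatrix (h : IsCriticalSection f ζ) (i j : Fin n) :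
    ContDiff ℝ ∞ fun k => remainderMatrix f ζ k i j := by
  have hγ := contDiff_graphCurve h.contDiff_section
  have hf2 : ContDiff ℝ ∞ (fderiv ℝ (fderiv ℝ f)) :=
    (h.contDiff.fderiv_right (m := ∞) (by simp)).fderiv_right (m := ∞) (by simp)
  have h0 : ContDiff ℝ ∞ fun p : (Fin (n + 1) → ℝ) × ℝ => graphCurve ζ (p.1 0) :=
    hγ.comp ((contDiff_apply ℝ ℝ (0 : Fin (n + 1))).comp contDiff_fst)
  refine contDiff_parametric_integral (G := fun p : (Fin (n + 1) → ℝ) × ℝ => (1 - p.2) *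
    fderiv ℝ (fderiv ℝ f) (graphCurve ζ (p.1 0) + p.2 • (p.1 - graphCurve ζ (p.1 0)))
      (Pi.single i.succ 1) (Pi.single j.succ 1)) ?_
  exact (contDiff_const.sub contDiff_snd).mul
    (((hf2.comp (h0.add (contDiff_snd.smul (contDiff_fst.sub h0)))).clm_apply
      contDiff_const).clm_apply contDiff_const)

lemma remainderMatrix_transpose (h : IsCriticalSection f ζ) (k : Fin (n + 1) → ℝ) :
    (remainderMatrix f ζ k)ᵀ = remainderMatrix f ζ k := by
  ext i j
  simp only [remainderMatrix, Matrix.transpose_apply, Matrix.of_apply]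
  simp_rw [fderiv_fderiv_symm h.contDiff _ (Pi.single j.succ 1)]

lemma remainderMatrix_zero (h : IsCriticalSection f ζ) :
    remainderMatrix f ζ 0 = (2⁻¹ : ℝ) • hess f := by
  ext i j
  have : ∫ t in (0 : ℝ)..1, (1 - t) = 2⁻¹ := by
    rw [intervalIntegral.integral_sub (by simp) (by simp)]
    simp
    norm_num
  simp [remainderMatrix, h.graphCurve_zero, hess_apply h.contDiff, this]

lemma isUnit_det_remainderMatrix (h : IsCriticalSection f ζ) :
    IsUnit (remainderMatrix f ζ 0).det := by
  rw [h.remainderMatrix_zero, Matrix.det_smul]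
  exact ((isUnit_iff_ne_zero.2 (by norm_num)).pow _).mul (h.kernel.isUnit_det_hess h.contDiff)

/-- Since `f_z` vanishes at `(y, ζ(y))`, the function `f` is there the sum of its value and a
quadratic form in `z - ζ(y)` with variable coefficients. -/
lemma eq_add_remainder (h : IsCriticalSection f ζ) : ∀ᶠ k in 𝓝 (0 : Fin (n + 1) → ℝ),
    f k = f (graphCurve ζ (k 0)) +
      (fun i : Fin n => k i.succ - ζ (k 0) i) ⬝ᵥ
        (remainderMatrix f ζ k *ᵥ fun i : Fin n => k i.succ - ζ (k 0) i) := by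
  have hf2 : ContDiff ℝ ∞ (fderiv ℝ (fderiv ℝ f)) :=
    (h.contDiff.fderiv_right (m := ∞) (by simp)).fderiv_right (m := ∞) (by simp)
  have h0 : Tendsto (fun k : Fin (n + 1) → ℝ => k 0) (𝓝 0) (𝓝 0) :=
    (continuous_apply (0 : Fin (n + 1))).tendsto 0
  filter_upwards [h0.eventually h.critical] with k hk
  have ht := taylor_two_integral h.contDiff (graphCurve ζ (k 0)) (k - graphCurve ζ (k 0))
  set p := graphCurve ζ (k 0) with hp
  set w : Fin n → ℝ := fun i => k i.succ - ζ (k 0) i with hw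
  have hw0 : (k - p) 0 = 0 := by simp [hp, graphCurve]
  have hws : ∀ i : Fin n, (k - p) i.succ = w i := fun i => by simp [hp, graphCurve, hw]
  have hlin : fderiv ℝ f p (k - p) = 0 := by
    rw [clm_apply_eq_sum, Fin.sum_univ_succ, hw0]
    simp only [partialD] at hk
    simp [hk]
  have hquad : ∀ x, fderiv ℝ (fderiv ℝ f) x (k - p) (k - p) = ∑ i : Fin n, ∑ j : Fin n,
      w i * w j * fderiv ℝ (fderiv ℝ f) x (Pi.single i.succ 1) (Pi.single j.succ 1) := fun x => by
    rw [clm_apply_eq_sum (fderiv ℝ (fderiv ℝ f) x), Fin.sum_univ_succ, hw0]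
    simp only [zero_smul, zero_add, sum_apply, smul_apply, hws]
    refine Finset.sum_congr rfl fun i _ => ?_
    rw [clm_apply_eq_sum, Fin.sum_univ_succ, hw0]
    simp only [smul_eq_mul, zero_mul, zero_add, hws, Finset.mul_sum, mul_assoc]
  have hcont : ∀ i j : Fin n, Continuous fun t : ℝ => w i * w j * ((1 - t) *
      fderiv ℝ (fderiv ℝ f) (p + t • (k - p)) (Pi.single i.succ 1) (Pi.single j.succ 1)) :=
    fun i j => by
      have := hf2.continuous
      fun_prop
  rw [add_sub_cancel, hlin, add_zero] at ht
  rw [ht]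
  congr 1
  have hsum : ∀ t : ℝ, (1 - t) * fderiv ℝ (fderiv ℝ f) (p + t • (k - p)) (k - p) (k - p) =
      ∑ i : Fin n, ∑ j : Fin n, w i * w j * ((1 - t) *
        fderiv ℝ (fderiv ℝ f) (p + t • (k - p)) (Pi.single i.succ 1) (Pi.single j.succ 1)) :=
    fun t => by
      rw [hquad, Finset.mul_sum]
      refine Finset.sum_congr rfl fun i _ => ?_
      rw [Finset.mul_sum]
      refine Finset.sum_congr rfl fun j _ => ?_
      ring
  simp_rw [hsum]
  rw [intervalIntegral.integral_finsetSum fun i _ =>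
    (continuous_finsetSum _ fun j _ => hcont i j).intervalIntegrable 0 1]
  simp only [dotProduct, Matrix.mulVec, remainderMatrix, Matrix.of_apply, Finset.mul_sum]
  refine Finset.sum_congr rfl fun i _ => ?_
  rw [intervalIntegral.integral_finsetSum fun j _ => (hcont i j).intervalIntegrable 0 1]
  refine Finset.sum_congr rfl fun j _ => ?_
  rw [intervalIntegral.integral_const_mul]
  ring

end IsCriticalSection

/-- The quadratic form `x ↦ ⟨x, A x⟩` of a nonsingular symmetric matrix is nondegenerate. -/
lemma exists_nondegenerate_quadraticForm {A : Matrix (Fin n) (Fin n) ℝ} (hA : Aᵀ = A)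
    (hdet : IsUnit A.det) :
    ∃ Q : QuadraticForm ℝ (Fin n → ℝ), Q.Nondegenerate ∧ ∀ x, Q x = x ⬝ᵥ (A *ᵥ x) := by
  let Q : QuadraticForm ℝ (Fin n → ℝ) := A.toQuadraticForm'
  have hQ : ∀ x, Q x = x ⬝ᵥ (A *ᵥ x) := fun x => by
    simp [Q, Matrix.toQuadraticForm', Matrix.toLinearMap₂'_apply']
  refine ⟨Q, ?_, hQ⟩
  have : Invertible (2 : ℝ) := invertibleOfNonzero two_ne_zero
  rw [QuadraticMap.nondegenerate_iff_radical_eq_bot, eq_bot_iff]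
  intro x hx
  have hAx : A *ᵥ x = 0 := by
    refine dotProduct_eq_zero _ fun y => ?_
    have hy := (QuadraticMap.mem_radical_iff'.1 hx).2 y
    have hx0 := (QuadraticMap.mem_radical_iff'.1 hx).1
    rw [hQ, hQ, Matrix.mulVec_add, add_dotProduct, dotProduct_add, dotProduct_add, ← hQ x, hx0,
      dotProduct_mulVec_comm hA x y, dotProduct_comm y (A *ᵥ x)] at hy
    linarith
  have := Matrix.mulVec_injective_iff_isUnit.2 ((Matrix.isUnit_iff_isUnit_det A).2 hdet)
  exact this (hAx.trans (Matrix.mulVec_zero A).symm)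

end Remainder

/-! ### Reduction to the normal form -/

section NormalForm

variable {n : ℕ} {f : (Fin (n + 1) → ℝ) → ℝ} {ζ : ℝ → Fin n → ℝ}

/-- A smooth function of one variable with leading term of order `N` is, near `0`, equal to
`c θ(y)^N`, where `θ` is a local coordinate and `c` is any number of the right sign. -/
lemma exists_coordinate_pow {g : ℝ → ℝ} (hg : ContDiff ℝ ∞ g) {N : ℕ} (hN : N ≠ 0)
    (h0 : ∀ j < N, iteratedDeriv j g 0 = 0) {c : ℝ} (hc : 0 < c * iteratedDeriv N g 0) :
    ∃ (θ : ℝ → ℝ) (r : ℝ), r ≠ 0 ∧ (∀ᶠ y in 𝓝 0, ContDiffAt ℝ ∞ θ y) ∧ θ 0 = 0 ∧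
      HasDerivAt θ r 0 ∧ ∀ᶠ y in 𝓝 0, g y = c * θ y ^ N := by
  obtain ⟨u, hu, hgu, hu0⟩ := exists_eq_pow_mul hg N h0
  have hcu : 0 < u 0 / c := by
    rw [hu0] at hc
    have hc0 : c ≠ 0 := by rintro rfl; simp at hc
    have : 0 < c * u 0 := by
      have hfac : (0 : ℝ) < N.factorial := by positivity
      refine pos_of_mul_pos_right (a := (N.factorial : ℝ)) ?_ hfac.le
      linarith
    rw [div_eq_mul_inv, ← mul_pos_iff_of_pos_left (sq_pos_of_ne_zero hc0)]
    field_simp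
    exact this
  have hc0 : c ≠ 0 := by rintro rfl; simp at hcu
  have hpos : ∀ᶠ y in 𝓝 (0 : ℝ), 0 < u y / c :=
    (hu.continuous.div_const c).continuousAt.eventually (lt_mem_nhds hcu)
  -- `θ(y) = y (u(y) / c)^(1/N)`, where `g(y) = y^N u(y)`
  let ρ : ℝ → ℝ := fun y => (u y / c) ^ ((N : ℝ)⁻¹)
  have hρ : ∀ y, 0 < u y / c → ContDiffAt ℝ ∞ ρ y := fun y hy =>
    (hu.contDiffAt.div_const c).rpow_const_of_ne hy.ne'
  refine ⟨fun y => y * ρ y, ρ 0, (Real.rpow_pos_of_pos hcu _).ne', ?_, by simp, ?_, ?_⟩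
  · filter_upwards [hpos] with y hy
    exact contDiffAt_id.mul (hρ y hy)
  · have := (hasDerivAt_id' (0 : ℝ)).fun_mul
      ((hρ 0 hcu).differentiableAt (by simp)).hasDerivAt
    simpa using this
  · filter_upwards [hpos] with y hy
    have : ρ y ^ N = u y / c := Real.rpow_inv_natCast_pow hy.le hN
    rw [hgu, mul_pow, this]
    field_simp

namespace IsCriticalSection

/-- If the first nonzero Taylor coefficient of `f(y, ζ(y)) - f(0)` is that of order `μ + 1`, then
`f` reduces to `c x^{μ+1}` for each `c` of the same sign. -/
lemma reducesTo (h : IsCriticalSection f ζ) {μ : ℕ}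
    (h0 : ∀ j < μ, curveD f ζ j (Pi.single 0 1) = 0) {c : ℝ}
    (hc : 0 < c * curveD f ζ μ (Pi.single 0 1)) :
    ReducesTo f fun x => c * x ^ (μ + 1) := by
  -- the restriction of `f` to the curve of transversal critical points
  let g : ℝ → ℝ := fun y => -f 0 + f (graphCurve ζ y)
  have hfγ : ContDiff ℝ ∞ fun y => f (graphCurve ζ y) :=
    h.contDiff.comp (contDiff_graphCurve h.contDiff_section)
  have hg : ContDiff ℝ ∞ g := contDiff_const.add hfγ
  have hgD : ∀ j, iteratedDeriv (j + 1) g 0 = curveD f ζ j (Pi.single 0 1) := fun j => by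
    rw [← h.curveD_succ_zero, curveD, multiD_zero, iteratedDeriv_const_add (by omega)]
  obtain ⟨θ, r, hr, hθ, hθ0, hθr, hgθ⟩ := exists_coordinate_pow hg (N := μ + 1) (by omega)
    (fun j hj => by
      cases j with
      | zero => simp [g, h.graphCurve_zero]
      | succ j => rw [hgD]; exact h0 j (by omega)) (c := c) (by rw [hgD]; exact hc)
  obtain ⟨B, hB, hB0, hBM⟩ := exists_smooth_congruence h.contDiff_remainderMatrix
    h.remainderMatrix_transpose h.isUnit_det_remainderMatrix
  obtain ⟨Q, hQ, hQval⟩ := exists_nondegenerate_quadraticForm (h.remainderMatrix_transpose 0)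
    h.isUnit_det_remainderMatrix
  let w : (Fin (n + 1) → ℝ) → Fin n → ℝ := fun k i => k i.succ - ζ (k 0) i
  have hw : ∀ i, ContDiff ℝ ∞ fun k => w k i := fun i =>
    (contDiff_apply ℝ ℝ i.succ).sub ((contDiff_pi.1 h.contDiff_section i).comp
      (contDiff_apply ℝ ℝ (0 : Fin (n + 1))))
  have hw0 : w 0 = 0 := by
    funext i
    simp [w, h.section_zero]
  -- the new coordinates are `θ(y)` and `B(k) (z - ζ(y))`
  let Φ : (Fin (n + 1) → ℝ) → Fin (n + 1) → ℝ := fun k => Fin.cons (θ (k 0)) (B k *ᵥ w k)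
  have hk0 : Tendsto (fun k : Fin (n + 1) → ℝ => k 0) (𝓝 0) (𝓝 0) :=
    (continuous_apply (0 : Fin (n + 1))).tendsto 0
  have hΦ : ∀ᶠ k in 𝓝 0, ContDiffAt ℝ ∞ Φ k := by
    filter_upwards [hk0.eventually hθ] with k hk
    refine contDiffAt_pi.2 fun i => ?_
    refine Fin.cases ?_ (fun i => ?_) i
    · have : ContDiffAt ℝ ∞ (fun k : Fin (n + 1) → ℝ => θ (k 0)) k :=
        ContDiffAt.comp k hk (contDiff_apply ℝ ℝ (0 : Fin (n + 1))).contDiffAt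
      exact this
    · have : ContDiff ℝ ∞ fun k => ∑ j, B k i j * w k j :=
        ContDiff.sum fun j _ => (hB i j).mul (hw j)
      exact this.contDiffAt
  -- their differential at `0` is diagonal, because `ζ'(0) = 0` and `B(0) = 1`
  let e : (Fin (n + 1) → ℝ) ≃L[ℝ] Fin (n + 1) → ℝ := ContinuousLinearEquiv.piCongrRight fun i =>
    ContinuousLinearEquiv.smulLeft (Units.mk0 ((Fin.cons r 1 : Fin (n + 1) → ℝ) i)
      (Fin.cases hr (fun _ => one_ne_zero) i))
  have he_apply : ∀ v i, e v i = (Fin.cons r 1 : Fin (n + 1) → ℝ) i * v i := fun _ _ => rfl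
  have he : HasFDerivAt Φ (e : (Fin (n + 1) → ℝ) →L[ℝ] Fin (n + 1) → ℝ) 0 := by
    have hproj : ∀ i : Fin (n + 1), HasFDerivAt (fun k : Fin (n + 1) → ℝ => k i)
      (ContinuousLinearMap.proj (R := ℝ) (φ := fun _ : Fin (n + 1) => ℝ) i) 0 :=
      fun i => hasFDerivAt_apply i 0
    refine hasFDerivAt_pi'.2 fun i => ?_
    refine Fin.cases ?_ (fun i => ?_) i
    · have := HasDerivAt.comp_hasFDerivAt (0 : Fin (n + 1) → ℝ) (f := fun k => k 0)
        (h₂ := θ) (h₂' := r) (by simpa using hθr) (hproj 0)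
      refine this.congr_fderiv ?_
      ext v
      simp [he_apply]
    · have hζ : ∀ j, HasDerivAt (fun y => ζ y j) 0 0 := fun j => by
        have := h.sectionD_one j
        rw [sectionD, iteratedDeriv_one] at this
        have hd :=
          ((contDiff_pi.1 h.contDiff_section j).differentiable (by simp) 0).hasDerivAt
        rwa [this] at hd
      have hwd : ∀ j, HasFDerivAt (fun k => w k j)
          (ContinuousLinearMap.proj (R := ℝ) (φ := fun _ : Fin (n + 1) => ℝ) j.succ) 0 :=
        fun j => by
          have := HasDerivAt.comp_hasFDerivAt (0 : Fin (n + 1) → ℝ) (f := fun k => k 0)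
            (h₂ := fun y => ζ y j) (h₂' := 0) (by simpa using hζ j) (hproj 0)
          simpa using (hproj j.succ).fun_sub this
      have := HasFDerivAt.fun_sum (u := Finset.univ) (x := (0 : Fin (n + 1) → ℝ))
        fun j _ => ((hB i j).differentiable (by simp) 0).hasFDerivAt.fun_mul (hwd j)
      refine this.congr_fderiv ?_
      ext v
      simp [he_apply, hw0, hB0, Matrix.one_apply]
  have hmain : ∀ᶠ k in 𝓝 0,
      f k = f 0 + c * Φ k 0 ^ (μ + 1) + Q fun i : Fin n => Φ k i.succ := by
    filter_upwards [h.eq_add_remainder, hBM, hk0.eventually hgθ] with k hk1 hk2 hk3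
    have hQw : Q (fun i : Fin n => Φ k i.succ) = w k ⬝ᵥ (remainderMatrix f ζ k *ᵥ w k) := by
      have : (fun i : Fin n => Φ k i.succ) = B k *ᵥ w k := rfl
      rw [this, hQval, ← hk2, ← Matrix.mulVec_mulVec, ← Matrix.mulVec_mulVec,
        Matrix.dotProduct_mulVec (w k), Matrix.vecMul_transpose]
    rw [hQw]
    have hΦ0 : Φ k 0 = θ (k 0) := rfl
    rw [hΦ0, ← hk3, hk1]
    simp only [g]
    ring
  obtain ⟨φ, hφ0, hsub, hφ, hsm, hsm'⟩ := exists_smooth_openPartialHomeomorph hΦ e he hmain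
  refine ⟨f 0, Q, φ, hQ, hφ0, ?_, hsm, hsm', fun k hk => ?_⟩
  · rw [hφ]
    funext i
    refine Fin.cases ?_ (fun i => ?_) i
    · simp [Φ, hθ0]
    · simp [Φ, hw0]
  · rw [hφ]
    exact hsub hk

end IsCriticalSection

end NormalForm

/-! ### Uniqueness of the normal form -/

section GradientOrder

open Asymptotics

variable {E : Type*} [NormedAddCommGroup E] [NormedSpace ℝ E]

/-- The differential of `f` vanishes to order at least `N` along some curve through the origin with
nonzero velocity there. For a singularity of type `A_μ` this holds exactly when `N ≤ μ`; the
property does not depend on the choice of coordinates. -/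
def GradientVanishes (f : E → ℝ) (N : ℕ) : Prop :=
  ∃ (γ : ℝ → E) (v : E), v ≠ 0 ∧ γ 0 = 0 ∧ HasDerivAt γ v 0 ∧
    (fun t => fderiv ℝ f (γ t)) =O[𝓝 0] fun t : ℝ => t ^ N

lemma GradientVanishes.mono {f : E → ℝ} {M N : ℕ} (hMN : M ≤ N) (h : GradientVanishes f N) :
    GradientVanishes f M := by
  obtain ⟨γ, v, hv, h0, hd, hO⟩ := h
  refine ⟨γ, v, hv, h0, hd, hO.trans ?_⟩
  rcases hMN.eq_or_lt with rfl | hlt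
  · exact isBigO_refl _ _
  · exact (isLittleO_pow_pow hlt).isBigO

/-- Invariance under changes of variables fixing the origin. -/
lemma GradientVanishes.comp_symm {F G : E → ℝ} {N : ℕ} (h : GradientVanishes F N)
    (hF : Differentiable ℝ F) (φ : OpenPartialHomeomorph E E) (h0 : 0 ∈ φ.source) (hφ0 : φ 0 = 0)
    (hφ : ContDiffOn ℝ ∞ φ φ.source) (hφ' : ContDiffOn ℝ ∞ φ.symm φ.target)
    (hG : ∀ x ∈ φ.target, G x = F (φ.symm x)) : GradientVanishes G N := by
  obtain ⟨γ, v, hv, hγ0, hd, hO⟩ := h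
  have h0t : (0 : E) ∈ φ.target := hφ0 ▸ φ.map_source h0
  have hdφ : HasFDerivAt φ (fderiv ℝ φ 0) 0 :=
    ((hφ.contDiffAt (φ.open_source.mem_nhds h0)).differentiableAt (by simp)).hasFDerivAt
  have hsymm : ∀ x ∈ φ.target, ContDiffAt ℝ ∞ φ.symm x := fun x hx =>
    hφ'.contDiffAt (φ.open_target.mem_nhds hx)
  have hdφ' : HasFDerivAt φ.symm (fderiv ℝ φ.symm 0) 0 :=
    ((hsymm 0 h0t).differentiableAt (by simp)).hasFDerivAt
  have hδ : HasDerivAt (fun t => φ (γ t)) (fderiv ℝ φ 0 v) 0 :=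
    HasFDerivAt.comp_hasDerivAt 0 (by rw [hγ0]; exact hdφ) hd
  have hsrc : ∀ᶠ t in 𝓝 (0 : ℝ), γ t ∈ φ.source :=
    hd.continuousAt.eventually_mem (by rw [hγ0]; exact φ.open_source.mem_nhds h0)
  refine ⟨fun t => φ (γ t), fderiv ℝ φ 0 v, fun hzero => hv ?_, by simp [hγ0, hφ0], hδ, ?_⟩
  · have h1 : HasDerivAt (fun t => φ.symm (φ (γ t))) (fderiv ℝ φ.symm 0 (fderiv ℝ φ 0 v)) 0 :=
      HasFDerivAt.comp_hasDerivAt (l := φ.symm) (f := fun t => φ (γ t)) 0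
        (by simp only [hγ0, hφ0]; exact hdφ') hδ
    have h2 : HasDerivAt γ (fderiv ℝ φ.symm 0 (fderiv ℝ φ 0 v)) 0 :=
      h1.congr_of_eventuallyEq (by
        filter_upwards [hsrc] with t ht
        exact (φ.left_inv ht).symm)
    rw [hd.unique h2, hzero, map_zero]
  · have hcont : ContinuousAt (fun t => fderiv ℝ φ.symm (φ (γ t))) 0 := by
      refine ContinuousAt.comp (f := fun t => φ (γ t)) ?_ hδ.continuousAt
      simp only [hγ0, hφ0]
      exact ((hsymm 0 h0t).fderiv_right (m := 0) (by simp)).continuousAt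
    have hB : (fun t => fderiv ℝ φ.symm (φ (γ t))) =O[𝓝 0] fun _ => (1 : ℝ) :=
      hcont.tendsto.isBigO_one ℝ
    have hprod := hO.norm_left.mul hB.norm_left
    simp only [mul_one] at hprod
    refine IsBigO.trans (IsBigO.of_bound 1 ?_) hprod
    filter_upwards [hsrc] with t ht
    have hGt : G =ᶠ[𝓝 (φ (γ t))] F ∘ φ.symm := by
      filter_upwards [φ.open_target.mem_nhds (φ.map_source ht)] with x hx
      exact hG x hx
    rw [hGt.fderiv_eq, fderiv_comp _ (hF _)
      ((hsymm _ (φ.map_source ht)).differentiableAt (by simp)), φ.left_inv ht, one_mul,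
      Real.norm_of_nonneg (by positivity)]
    exact ContinuousLinearMap.opNorm_comp_le _ _

lemma hasDerivAt_eq_zero_of_isBigO {u : ℝ → ℝ} {d : ℝ} {N : ℕ} (hN : 2 ≤ N)
    (hu : HasDerivAt u d 0) (hu0 : u 0 = 0) (hO : u =O[𝓝 0] fun t : ℝ => t ^ N) : d = 0 := by
  refine hu.unique (hasDerivAt_iff_isLittleO.2 ?_)
  have : (fun t : ℝ => t ^ N) =o[𝓝 0] fun t : ℝ => t := by
    simpa using isLittleO_pow_pow (𝕜 := ℝ) (show 1 < N by omega)
  simpa [hu0] using hO.trans_isLittleO this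

variable {n : ℕ}

/-- The differential of the normal form. -/
lemma hasFDerivAt_normalForm (a c : ℝ) (μ : ℕ) (Q : QuadraticForm ℝ (Fin n → ℝ))
    (x : Fin (n + 1) → ℝ) :
    ∃ L : (Fin (n + 1) → ℝ) →L[ℝ] ℝ,
      HasFDerivAt (fun k : Fin (n + 1) → ℝ =>
        a + c * k 0 ^ (μ + 1) + Q fun i : Fin n => k i.succ) L x ∧
      ∀ v, L v = c * ((μ + 1) * x 0 ^ μ * v 0) +
        Q.polarBilin (fun i => x i.succ) fun i => v i.succ := by
  let b := LinearMap.toContinuousBilinearMap (QuadraticMap.associated (R := ℝ) Q)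
  have hb : ∀ z, Q z = b z z := fun z => (QuadraticMap.associated_eq_self_apply ℝ Q z).symm
  let T : (Fin (n + 1) → ℝ) →L[ℝ] Fin n → ℝ :=
    ContinuousLinearMap.pi fun i => ContinuousLinearMap.proj i.succ
  have h0 : HasFDerivAt (fun k : Fin (n + 1) → ℝ => k 0)
    (ContinuousLinearMap.proj (R := ℝ) (φ := fun _ : Fin (n + 1) => ℝ) 0) x :=
    hasFDerivAt_apply 0 x
  have hpow : HasFDerivAt (fun k : Fin (n + 1) → ℝ => k 0 ^ (μ + 1)) _ x :=
    HasDerivAt.comp_hasFDerivAt (h₂ := fun y : ℝ => y ^ (μ + 1)) x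
      (hasDerivAt_pow (μ + 1) (x 0)) h0
  have h1 := (hpow.const_mul c).const_add a
  have h2 : HasFDerivAt (fun k => b (T k) (T k)) _ x :=
    (b.hasFDerivAt.comp x T.hasFDerivAt).clm_apply T.hasFDerivAt
  have hQ : (fun k : Fin (n + 1) → ℝ => a + c * k 0 ^ (μ + 1) + Q fun i : Fin n => k i.succ) =
      fun k => a + c * k 0 ^ (μ + 1) + b (T k) (T k) := by
    funext k
    rw [← hb]
    rfl
  rw [hQ]
  refine ⟨_, h1.fun_add h2, fun v => ?_⟩
  have hT : ∀ k, T k = fun i => k i.succ := fun _ => rfl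
  have hp : ∀ y z, Q.polarBilin y z = b y z + b z y := fun y z => by
    have : Q (y + z) = Q y + Q z + Q.polarBilin y z := by
      simp [QuadraticMap.polar]
    rw [hb, hb, hb] at this
    simp only [map_add, add_apply] at this
    linarith
  rw [hp]
  simp [hT]

lemma gradientVanishes_normalForm (a c : ℝ) (μ : ℕ) (Q : QuadraticForm ℝ (Fin n → ℝ)) :
    GradientVanishes (fun k : Fin (n + 1) → ℝ =>
      a + c * k 0 ^ (μ + 1) + Q fun i : Fin n => k i.succ) μ := by
  let e₀ : Fin (n + 1) → ℝ := Pi.single 0 1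
  refine ⟨fun t => t • e₀, e₀, by simp [e₀], by simp, by
    simpa using (hasDerivAt_id (0 : ℝ)).smul_const e₀, ?_⟩
  have hval : ∀ t : ℝ, fderiv ℝ (fun k : Fin (n + 1) → ℝ =>
      a + c * k 0 ^ (μ + 1) + Q fun i : Fin n => k i.succ) (t • e₀) =
      t ^ μ • ((c * (μ + 1)) •
        ContinuousLinearMap.proj (R := ℝ) (φ := fun _ : Fin (n + 1) => ℝ) 0) := fun t => by
    obtain ⟨L, hL, hLv⟩ := hasFDerivAt_normalForm a c μ Q (t • e₀)
    rw [hL.fderiv]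
    ext v
    have : (fun i : Fin n => (t • e₀) i.succ) = 0 := by
      funext i
      simp [e₀]
    rw [hLv, this]
    simp [e₀]
    ring
  simp_rw [hval]
  refine IsBigO.of_bound ‖(c * (μ + 1)) •
    ContinuousLinearMap.proj (R := ℝ) (φ := fun _ : Fin (n + 1) => ℝ) 0‖ ?_
  exact Eventually.of_forall fun t => by rw [norm_smul, mul_comm]

lemma not_gradientVanishes_normalForm (a : ℝ) {c : ℝ} (hc : c ≠ 0) {μ : ℕ} (hμ : 1 ≤ μ)
    {Q : QuadraticForm ℝ (Fin n → ℝ)} (hQ : Q.Nondegenerate) :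
    ¬ GradientVanishes (fun k : Fin (n + 1) → ℝ =>
      a + c * k 0 ^ (μ + 1) + Q fun i : Fin n => k i.succ) (μ + 1) := by
  rintro ⟨γ, v, hv, hγ0, hd, hO⟩
  choose L hL hLv using hasFDerivAt_normalForm a c μ Q
  simp_rw [(hL _).fderiv] at hO
  have hOw : ∀ w, (fun t => L (γ t) w) =O[𝓝 0] fun t : ℝ => t ^ (μ + 1) := fun w => by
    refine IsBigO.trans (IsBigO.of_bound ‖w‖ (Eventually.of_forall fun t => ?_)) hO
    rw [mul_comm]
    exact (L (γ t)).le_opNorm w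
  -- the transversal part of the velocity vanishes, since `Q` is nondegenerate
  have htrans : (fun i : Fin n => v i.succ) = 0 := by
    have hker : (fun i : Fin n => v i.succ) ∈ Q.polarBilin.ker := by
      refine LinearMap.mem_ker.2 (LinearMap.ext fun z => ?_)
      let ℓ : (Fin (n + 1) → ℝ) →ₗ[ℝ] ℝ :=
        (Q.polarBilin.flip z).comp (LinearMap.funLeft ℝ ℝ (Fin.succ : Fin n → Fin (n + 1)))
      have hℓ : HasDerivAt (fun t => LinearMap.toContinuousLinearMap ℓ (γ t))
          (LinearMap.toContinuousLinearMap ℓ v) 0 :=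
        (LinearMap.toContinuousLinearMap ℓ).hasFDerivAt.comp_hasDerivAt 0 hd
      refine hasDerivAt_eq_zero_of_isBigO (N := μ + 1) (by omega) hℓ (by simp [hγ0]) ?_
      have hw := hOw (Fin.cons 0 z)
      simp_rw [hLv] at hw
      simpa [ℓ, LinearMap.funLeft, Function.comp_def] using hw
    have hinv : Invertible (2 : ℝ) := invertibleOfNonzero two_ne_zero
    rw [← QuadraticMap.radical_eq_ker_polarBilin, hQ.radical_eq_bot] at hker
    simpa using hker
  have hv0 : v 0 ≠ 0 := fun h => hv (by
    funext i
    exact Fin.cases h (fun i => congrFun htrans i) i)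
  -- hence the first coordinate of the curve is of order `t`, and its `μ`-th power is not `o(t^μ)`
  have hslope : Tendsto (fun t : ℝ => t⁻¹ * γ t 0) (𝓝[≠] 0) (𝓝 (v 0)) := by
    simpa [hγ0] using (hasDerivAt_pi.1 hd 0).tendsto_slope_zero
  have hpow := hslope.pow μ
  have hO0 : (fun t => γ t 0 ^ μ) =O[𝓝 0] fun t : ℝ => t ^ (μ + 1) := by
    have hw := (hOw (Pi.single 0 1)).const_mul_left (c * (μ + 1))⁻¹
    refine hw.congr_left fun t => ?_
    have hz : (fun i : Fin n => (Pi.single 0 1 : Fin (n + 1) → ℝ) i.succ) = 0 := by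
      funext i
      simp
    have : (μ : ℝ) + 1 ≠ 0 := by positivity
    rw [hLv, hz, map_zero]
    simp
    field_simp
  have hzero : Tendsto (fun t : ℝ => (t⁻¹ * γ t 0) ^ μ) (𝓝[≠] 0) (𝓝 0) := by
    have h1 := (isBigO_refl (fun t : ℝ => (t ^ μ)⁻¹) (𝓝[≠] 0)).mul
      (hO0.mono nhdsWithin_le_nhds)
    have h2 : (fun t : ℝ => (t⁻¹ * γ t 0) ^ μ) =O[𝓝[≠] 0] fun t : ℝ => t := by
      refine (h1.congr_left fun t => by rw [mul_pow, inv_pow]).congr' EventuallyEq.rfl ?_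
      filter_upwards [self_mem_nhdsWithin] with t ht
      have : t ≠ 0 := ht
      rw [pow_succ]
      field_simp
    exact h2.trans_tendsto (tendsto_nhdsWithin_of_tendsto_nhds tendsto_id)
  exact pow_ne_zero μ hv0 (tendsto_nhds_unique hpow hzero)

variable {f : (Fin (n + 1) → ℝ) → ℝ} {ζ : ℝ → Fin n → ℝ} {c : ℝ} {μ : ℕ}

lemma ReducesTo.gradientVanishes (h : ReducesTo f fun x => c * x ^ (μ + 1)) :
    GradientVanishes f μ := by
  obtain ⟨a, Q, φ, -, h0, hφ0, hφ, hφ', hf⟩ := h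
  have hφ0' : φ.symm 0 = 0 := by
    have := φ.left_inv h0
    rwa [hφ0] at this
  refine (gradientVanishes_normalForm a c μ Q).comp_symm
    (fun x => (hasFDerivAt_normalForm a c μ Q x).choose_spec.1.differentiableAt) φ.symm
    (hφ0 ▸ φ.map_source h0) hφ0' hφ' (by simpa using hφ) fun k hk => ?_
  simpa using hf k hk

lemma ReducesTo.not_gradientVanishes (hc : c ≠ 0) (hμ : 1 ≤ μ) (hf : ContDiff ℝ ∞ f)
    (h : ReducesTo f fun x => c * x ^ (μ + 1)) : ¬ GradientVanishes f (μ + 1) := by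
  obtain ⟨a, Q, φ, hQ, h0, hφ0, hφ, hφ', hfφ⟩ := h
  refine fun hgr => not_gradientVanishes_normalForm a hc hμ hQ (hgr.comp_symm
    (hf.differentiable (by simp)) φ h0 hφ0 hφ hφ' fun x hx => ?_)
  rw [hfφ _ (φ.map_target hx), φ.right_inv hx]

/-- Along the curve of transversal critical points the differential of `f` is that of the function
`f(y, ζ(y))` of one variable. -/
lemma IsCriticalSection.gradientVanishes (h : IsCriticalSection f ζ)
    (h0 : ∀ j < μ, curveD f ζ j (Pi.single 0 1) = 0) : GradientVanishes f μ := by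
  have hγ := contDiff_graphCurve h.contDiff_section
  have hd : HasDerivAt (graphCurve ζ) (deriv (graphCurve ζ) 0) 0 :=
    (hγ.differentiable (by simp) 0).hasDerivAt
  refine ⟨graphCurve ζ, _, fun hzero => ?_, h.graphCurve_zero, hd, ?_⟩
  · have h1 : HasDerivAt (fun y => graphCurve ζ y 0) 1 0 := hasDerivAt_id 0
    have := (hasDerivAt_pi.1 hd 0).unique h1
    rw [hzero] at this
    simp at this
  · obtain ⟨u, hu, hfu, -⟩ := exists_eq_pow_mul
      ((contDiff_multiD h.contDiff (Pi.single 0 1)).comp hγ) μ h0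
    have heq : (fun y => fderiv ℝ f (graphCurve ζ y)) =ᶠ[𝓝 0] fun y => (y ^ μ * u y) •
        ContinuousLinearMap.proj (R := ℝ) (φ := fun _ : Fin (n + 1) => ℝ) 0 := by
      filter_upwards [h.critical] with y hy
      ext v
      simp only [partialD] at hy
      rw [← hfu, clm_apply_eq_sum, Fin.sum_univ_succ]
      simp only [hy, Function.comp, multiD_single h.contDiff, partialD]
      simp [mul_comm]
    refine heq.trans_isBigO ?_
    have hO : (fun y => y ^ μ * u y) =O[𝓝 0] fun y : ℝ => y ^ μ := by
      simpa using (isBigO_refl (fun y : ℝ => y ^ μ) (𝓝 0)).mul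
        ((hu.continuous.tendsto 0).isBigO_one ℝ)
    refine IsBigO.trans (IsBigO.of_bound
      ‖ContinuousLinearMap.proj (R := ℝ) (φ := fun _ : Fin (n + 1) => ℝ) 0‖
      (Eventually.of_forall fun y => ?_)) hO
    rw [norm_smul, mul_comm]

end GradientOrder

lemma isTypeA_iff_exists {n μ : ℕ} {f : (Fin (n + 1) → ℝ) → ℝ} :
    IsTypeA μ f ↔ ∃ c : ℝ, (c = 1 ∨ c = -1) ∧ ReducesTo f fun x => c * x ^ (μ + 1) := by
  simp [IsTypeA, IsTypeAPlus, IsTypeAMinus, or_and_right, exists_or]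

/-- The type of the singularity is read off from the first nonvanishing coefficient. -/
lemma IsCriticalSection.isTypeA_iff {n μ : ℕ} {f : (Fin (n + 1) → ℝ) → ℝ}
    {ζ : ℝ → Fin n → ℝ} (h : IsCriticalSection f ζ) (hμ : 1 ≤ μ) :
    IsTypeA μ f ↔ (∀ j < μ, curveD f ζ j (Pi.single 0 1) = 0) ∧
      curveD f ζ μ (Pi.single 0 1) ≠ 0 := by
  constructor
  · rw [isTypeA_iff_exists]
    rintro ⟨c, hc, hred⟩
    have hc0 : c ≠ 0 := by rcases hc with rfl | rfl <;> norm_num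
    have hvan : ∀ j < μ, curveD f ζ j (Pi.single 0 1) = 0 := by
      intro j hj
      induction j using Nat.strong_induction_on with
      | _ j ih =>
      by_contra hne
      rcases Nat.eq_zero_or_pos j with rfl | hjpos
      · exact hne (by rw [h.curveD_zero, h.kernel.multiD_single h.contDiff])
      -- otherwise `f` would reduce both to a multiple of `x^(j+1)` and to one of `x^(μ+1)`
      · have hred' := h.reducesTo (fun i hi => ih i hi (hi.trans hj)) (mul_self_pos.2 hne)
        exact hred'.not_gradientVanishes hne hjpos h.contDiff (hred.gradientVanishes.mono hj)
    refine ⟨hvan, fun hzero => ?_⟩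
    refine hred.not_gradientVanishes hc0 hμ h.contDiff (h.gradientVanishes fun j hj => ?_)
    rcases Nat.lt_succ_iff_lt_or_eq.1 hj with hj | rfl
    · exact hvan j hj
    · exact hzero
  · rintro ⟨hvan, hne⟩
    rw [isTypeA_iff_exists]
    rcases lt_or_gt_of_ne hne with hneg | hpos
    · exact ⟨-1, Or.inr rfl, h.reducesTo hvan (by linarith)⟩
    · exact ⟨1, Or.inl rfl, h.reducesTo hvan (by linarith)⟩

end SingularityA

theorem mainTheorem3 (n : ℕ) :
    ∃ P : (μ : ℕ) → MvPolynomial (SingularityA.MixedIndex n μ ⊕ Fin n × Fin n) ℤ,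
      (∀ μ : ℕ, 2 ≤ μ → MvPolynomial.constantCoeff (P μ) = 0) ∧
      ∀ f : (Fin (n + 1) → ℝ) → ℝ, ContDiff ℝ ∞ f → SingularityA.KernelIsFirstAxis f →
        SingularityA.coeffA (P 2) f = SingularityA.tableA2 f ∧
        SingularityA.coeffA (P 3) f = SingularityA.tableA3 f ∧
        SingularityA.coeffA (P 4) f = SingularityA.tableA4 f ∧
        SingularityA.coeffA (P 5) f = SingularityA.tableA5 f ∧
        ∀ μ : ℕ, 2 ≤ μ →
          (SingularityA.IsTypeA μ f ↔
            (∀ j : ℕ, 2 ≤ j → j < μ → SingularityA.coeffA (P j) f = 0) ∧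
              SingularityA.coeffA (P μ) f ≠ 0) ∧
          ((∀ j : ℕ, 2 ≤ j → j < μ → SingularityA.coeffA (P j) f = 0) →
            SingularityA.coeffA (P μ) f ≠ 0 →
              SingularityA.ReducesTo f (fun x => SingularityA.coeffA (P μ) f * x ^ (μ + 1)) ∧
              (0 < SingularityA.coeffA (P μ) f → SingularityA.IsTypeAPlus μ f) ∧
              (SingularityA.coeffA (P μ) f < 0 → SingularityA.IsTypeAMinus μ f)) := by
  choose P hP0 hP using SingularityA.exists_polynomial_coeffA n
  refine ⟨P, fun μ _ => hP0 μ, fun f hf hk => ?_⟩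
  obtain ⟨ζ, h⟩ := SingularityA.exists_isCriticalSection hf hk
  simp_rw [fun μ => hP μ f ζ h]
  -- the coefficients of orders below `2` vanish for every admissible `f`
  have hlow : ∀ μ : ℕ,
      (∀ j : ℕ, 2 ≤ j → j < μ → SingularityA.curveD f ζ j (Pi.single 0 1) = 0) ↔
        ∀ j < μ, SingularityA.curveD f ζ j (Pi.single 0 1) = 0 := fun μ => by
    refine ⟨fun hj j hjμ => ?_, fun hj j _ hjμ => hj j hjμ⟩
    match j, hjμ with
    | 0, _ => rw [h.curveD_zero, hk.multiD_single hf]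
    | 1, _ =>
      have := h.curveD_one 1 0
      rwa [add_zero, add_zero, Pi.single_add, hk.multiD_zero_add_single hf] at this
    | j + 2, hjμ => exact hj _ (by omega) hjμ
  refine ⟨h.curveD_two_eq_tableA2, h.curveD_three_eq_tableA3, h.curveD_four_eq_tableA4,
    h.curveD_five_eq_tableA5, fun μ hμ => ?_⟩
  rw [hlow, ← h.isTypeA_iff (by omega)]
  refine ⟨Iff.rfl, fun hvan hne => ⟨h.reducesTo hvan (mul_self_pos.2 hne), fun hpos => ?_,
    fun hneg => ?_⟩⟩
  · simpa [SingularityA.IsTypeAPlus] using h.reducesTo hvan (c := 1) (by linarith)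
  · simpa [SingularityA.IsTypeAMinus] using h.reducesTo hvan (c := -1) (by linarith)
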